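/- Let $n\ge 2$ and $m\ge 1$ be integers, let $w_1\in\mathbb F_n$ and $w_2\in\mathbb F_m$ be elements of the free groups of rank $n$ and $m$ which are either both non-trivial or both trivial, and let $$G=\mathbb F_n *_{w_1=w_2}\mathbb F_m$$ be the amalgamated product of $\mathbb F_n$ and $\mathbb F_m$ identifying the cyclic subgroups $\langle w_1\rangle$ and $\langle w_2\rangle$ via $w_1\mapsto w_2$, that is, the quotient of the free product $\mathbb F_n*\mathbb F_m$ by the normal closure of $w_1w_2^{-1}$. Let $\mathrm{Homeo}_+(\mathbb R)$ be the group of orientation preserving homeomorphisms of the real line, with the compact-open topology, and endow the set $\mathrm{Rep}(G,\mathrm{Homeo}_+(\mathbb R))$ of homomorphisms $G\to \mathrm{Homeo}_+(\mathbb R)$ with the topology of pointwise convergence on $G$. A global fixed point of a representation $\rho$ is a point $x\in\mathbb R$ with $\rho(g)(x)=x$ for all $g\in G$. Two representations $\rho_1,\rho_2$ are semi-conjugated if there is a non-decreasing (not necessarily continuous) map $c:\mathbb R\to\mathbb R$ such that $c^{-1}(K)$ is bounded for every compact $K\subset\mathbb R$ and $c\circ\rho_1(g)=\rho_2(g)\circ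 c$ for all $g\in G$. A representation $\rho$ without global fixed points is locally rigid if it has a neighbourhood $U$ in $\mathrm{Rep}(G,\mathrm{Homeo}_+(\mathbb R))$ such that every $\rho'\in U$ without global fixed points is semi-conjugated to $\rho$, and it is flexible if it is not locally rigid. Then every representation $\rho:G\to\mathrm{Homeo}_+(\mathbb R)$ without global fixed points is flexible; that is, every neighbourhood of $\rho$ contains a representation without global fixed points that is not semi-conjugated to $\rho$. -/

import Mathlib

open Topology

/-- `Homeo₊(ℝ)`: the group (under composition) of orientation preserving, that is increasing,
homeomorphisms of the real line. -/
def HomeoPlus : Subgroup (ℝ ≃ₜ ℝ) where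
  carrier := {f | StrictMono f}
  mul_mem' {_ _} hf hg := fun _ _ hxy => hf (hg hxy)
  one_mem' := fun _ _ hxy => hxy
  inv_mem' {f} hf := fun x y hxy => by
    have h : f (f.symm x) < f (f.symm y) := by simpa using hxy
    exact hf.lt_iff_lt.1 h

/-- `Rep(G, Homeo₊(ℝ))`: the representations of `G` into `Homeo₊(ℝ)`. -/
def LineRep (G : Type*) [Group G] := G →* HomeoPlus

namespace LineRep

variable {G : Type*} [Group G]

/-- The homeomorphism `ρ(g)`, as a continuous map of the line. -/
def act (ρ : LineRep G) (g : G) : C(ℝ, ℝ) :=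
  (((show G →* HomeoPlus from ρ) g : ℝ ≃ₜ ℝ) : C(ℝ, ℝ))

/-- The topology of pointwise convergence on `Rep(G, Homeo₊(ℝ))`, where the group `Homeo₊(ℝ)`
carries the compact-open topology: it is induced from the product topology on `G → C(ℝ, ℝ)`. -/
instance : TopologicalSpace (LineRep G) :=
  TopologicalSpace.induced (fun ρ : LineRep G => (fun g : G => ρ.act g)) inferInstance

/-- The set `Fix(ρ)` of global fixed points. -/
def Fix (ρ : LineRep G) : Set ℝ := {x | ∀ g : G, ρ.act g x = x}

/-- `ρ₁` and `ρ₂` are semi-conjugated: there is a non-decreasing map `c` (not necessarily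
continuous), proper in the sense that preimages of compact sets are bounded, with
`c ∘ ρ₁(g) = ρ₂(g) ∘ c` for all `g`. -/
def SemiConjugated (ρ₁ ρ₂ : LineRep G) : Prop :=
  ∃ c : ℝ → ℝ, Monotone c ∧
    (∀ K : Set ℝ, IsCompact K → Bornology.IsBounded (c ⁻¹' K)) ∧
    ∀ (g : G) (x : ℝ), c (ρ₁.act g x) = ρ₂.act g (c x)

/-- `ρ` is locally rigid: every representation without global fixed points in some neighbourhood
of `ρ` is semi-conjugated to `ρ`. -/
def LocallyRigid (ρ : LineRep G) : Prop :=
  ∃ U ∈ 𝓝 ρ, ∀ ρ' ∈ U, ρ'.Fix = ∅ → SemiConjugated ρ' ρ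

/-- `ρ` is flexible: it is not locally rigid. -/
def Flexible (ρ : LineRep G) : Prop := ¬ LocallyRigid ρ

end LineRep

/-- The two factors `𝔽ₙ` (index `false`) and `𝔽ₘ` (index `true`). -/
abbrev FreeFactor (n m : ℕ) (b : Bool) : Type := FreeGroup (Fin (cond b m n))

/-- The homomorphisms `ℤ → 𝔽ₙ`, `k ↦ w₁ ^ k`, and `ℤ → 𝔽ₘ`, `k ↦ w₂ ^ k`. -/
def cyclicMap {n m : ℕ} (w₁ : FreeGroup (Fin n)) (w₂ : FreeGroup (Fin m)) :
    (b : Bool) → Multiplicative ℤ →* FreeFactor n m b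
  | false => zpowersHom (FreeGroup (Fin n)) w₁
  | true => zpowersHom (FreeGroup (Fin m)) w₂

/-- The amalgamated product `𝔽ₙ *_{w₁ = w₂} 𝔽ₘ`: the pushout of `𝔽ₙ ← ℤ → 𝔽ₘ`,
`w₁ ↤ 1 ↦ w₂`, that is, the free product of `𝔽ₙ` and `𝔽ₘ` with `w₁` and `w₂` identified. -/
abbrev CyclicAmalgam {n m : ℕ} (w₁ : FreeGroup (Fin n)) (w₂ : FreeGroup (Fin m)) : Type :=
  Monoid.PushoutI (cyclicMap w₁ w₂)

/-!
All modifications of a representation `ρ` of `𝔽ₙ *_{w₁ = w₂} 𝔽ₘ` are made near `+∞`: for every `K`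
there is a representation without global fixed points whose generators have, inside the quadrant
`(-∞, K]²`, the same graphs as those of `ρ`, and which is not mapped to `ρ` by a monotone
equivariant map tending to `+∞` at `+∞` (`deformable_of_isCyclicallyReduced`).  For `K → ∞` these
representations converge to `ρ`, hence `ρ` is flexible.  A representation is treated as a pair
of actions of the two free groups by order automorphisms of `ℝ` that satisfies `w₁ = w₂`, and
after twisting both actions by inner automorphisms the two words are cyclically reduced.

The invariant which forbids equivariant maps is, in most cases, the existence of an orbit of an
element `g` escaping to `+∞`: a monotone equivariant map tending to `+∞` carries it to an orbit of
`g` that escapes for `ρ` (`escape_of_semiconj`).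

Two constructions give freedom near `+∞`.  The letters of a reduced infinite word can be prescribed
to move a sequence `u 0 < u 1 < ⋯` step by step, because consecutive letters never cancel
(`exists_chain`); in rank at least two the word can moreover be ended by the powers of any
cyclically reduced word, and there are no fixed points along the chain
(`exists_fixedPointFree_escape`).  The equation `w = f` is solvable in the group of increasing
homeomorphisms for every non-trivial `w`: if `w` acts as a translation, one applies an endomorphism
of this group sending the translation to `f` (`exists_hom_mk_eq`).  Together they extend an
action of the second factor with a prescribed value of `w₂` (`exists_hom_inv_eq`).

* If `w₁` does not act trivially near `+∞`, the first action is changed by a chain so that `w₁`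
  escapes either upwards or downwards, and the second action is adapted; `ρ` cannot be compatible
  with both choices (`deformable_of_ne`).
* If `w₁` acts trivially near `+∞` and the first action has fixed points arbitrarily far to the
  right, it is replaced beyond one of them by an action through a homomorphism `𝔽ₙ → ℤ` killing `w₁`
  (`deformable_of_fixed`); this exists because `n ≥ 2`.
* If only the second action has such fixed points, it is cut at one of them, a chain makes an orbit
  of `w₁⁻¹` escape, and `w₂ = f` is solved beyond the cut (`deformable_of_fixed_right`).  When the
  words are trivial, the preceding case applies with the two factors exchanged.
* If neither action has fixed points near `+∞`, the second one is conjugated by a homeomorphism `φ`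
  supported near `+∞`.  An equivariant map `c` commutes with the first action and `c ∘ φ` commutes
  with the second one, which bounds the growth of `φ` (`deformable_of_bending`).
-/

/-! ### Interpolating monotone relations -/

/-- A strictly monotone relation between two closed unbounded sets of reals extends, by affine
interpolation on the gaps, to an increasing homeomorphism of the line. -/
theorem exists_orderIso_of_monotone_relation (S : Set (ℝ × ℝ))
    (hmono : ∀ p ∈ S, ∀ q ∈ S, p.1 < q.1 ↔ p.2 < q.2)
    (hc₁ : IsClosed (Prod.fst '' S)) (hc₂ : IsClosed (Prod.snd '' S))
    (hub₁ : ∀ b, ∃ p ∈ S, b ≤ p.1) (hlb₁ : ∀ b, ∃ p ∈ S, p.1 ≤ b)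
    (hub₂ : ∀ b, ∃ p ∈ S, b ≤ p.2) (hlb₂ : ∀ b, ∃ p ∈ S, p.2 ≤ b) :
    ∃ e : ℝ ≃o ℝ, ∀ p ∈ S, e p.1 = p.2 := by
  -- Closedness yields the points of `S` nearest to `x` on either side.
  have key : ∀ (π : ℝ × ℝ → ℝ), IsClosed (π '' S) → (∀ b, ∃ p ∈ S, b ≤ π p) →
      (∀ b, ∃ p ∈ S, π p ≤ b) → ∀ x, (∃ p ∈ S, π p ≤ x ∧ ∀ q ∈ S, π q ≤ x → π q ≤ π p) ∧
        ∃ p ∈ S, x ≤ π p ∧ ∀ q ∈ S, x ≤ π q → π p ≤ π q := by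
    intro π hc hub hlb x
    constructor
    · obtain ⟨p₀, hp₀, hp₀x⟩ := hlb x
      have hne : (π '' S ∩ Set.Iic x).Nonempty := ⟨_, ⟨p₀, hp₀, rfl⟩, hp₀x⟩
      have hbdd : BddAbove (π '' S ∩ Set.Iic x) := ⟨x, fun _ h => h.2⟩
      obtain ⟨⟨p, hp, hpe⟩, hpx⟩ := (hc.inter isClosed_Iic).csSup_mem hne hbdd
      refine ⟨p, hp, hpe ▸ hpx, fun q hq hqx => hpe ▸ le_csSup hbdd ⟨⟨q, hq, rfl⟩, hqx⟩⟩
    · obtain ⟨p₀, hp₀, hp₀x⟩ := hub x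
      have hne : (π '' S ∩ Set.Ici x).Nonempty := ⟨_, ⟨p₀, hp₀, rfl⟩, hp₀x⟩
      have hbdd : BddBelow (π '' S ∩ Set.Ici x) := ⟨x, fun _ h => h.2⟩
      obtain ⟨⟨p, hp, hpe⟩, hpx⟩ := (hc.inter isClosed_Ici).csInf_mem hne hbdd
      refine ⟨p, hp, hpe ▸ hpx, fun q hq hqx => hpe ▸ csInf_le hbdd ⟨⟨q, hq, rfl⟩, hqx⟩⟩
  have heq : ∀ p ∈ S, ∀ q ∈ S, p.1 = q.1 → p.2 = q.2 := by
    intro p hp q hq h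
    have h1 := hmono p hp q hq
    have h2 := hmono q hq p hp
    rw [h] at h1
    rw [h] at h2
    simp only [lt_self_iff_false, false_iff, not_lt] at h1 h2
    exact le_antisymm h2 h1
  choose l hlS hlx hlmax using fun x => (key Prod.fst hc₁ hub₁ hlb₁ x).1
  choose r hrS hrx hrmin using fun x => (key Prod.fst hc₁ hub₁ hlb₁ x).2
  let F : ℝ → ℝ := fun x =>
    (l x).2 + ((r x).2 - (l x).2) * ((x - (l x).1) / ((r x).1 - (l x).1))
  have hF : ∀ x, F x = (l x).2 + ((r x).2 - (l x).2) * ((x - (l x).1) / ((r x).1 - (l x).1)) :=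
    fun x => rfl
  have hFS : ∀ p ∈ S, F p.1 = p.2 := by
    intro p hp
    have h1 : (l p.1).1 = p.1 := le_antisymm (hlx _) (hlmax _ p hp le_rfl)
    have h2 := heq _ (hlS p.1) p hp h1
    rw [hF, h1, h2]; simp
  -- inside a gap, the value is given by the affine formula of the gap
  have hgap : ∀ p ∈ S, ∀ q ∈ S, (∀ s ∈ S, ¬ (p.1 < s.1 ∧ s.1 < q.1)) → ∀ x, p.1 < x → x < q.1 →
      F x = p.2 + (q.2 - p.2) * ((x - p.1) / (q.1 - p.1)) := by
    intro p hp q hq hn x hpx hxq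
    have h1 : (l x).1 = p.1 := by
      refine le_antisymm (not_lt.1 fun h => hn _ (hlS x) ⟨h, (hlx x).trans_lt hxq⟩)
        (hlmax x p hp hpx.le)
    have h2 : (r x).1 = q.1 := by
      refine le_antisymm (hrmin x q hq hxq.le)
        (not_lt.1 fun h => hn _ (hrS x) ⟨hpx.trans_le (hrx x), h⟩)
    rw [hF, h1, h2, heq _ (hlS x) p hp h1, heq _ (hrS x) q hq h2]
  have hnS : ∀ x, (∀ p ∈ S, p.1 ≠ x) → (l x).1 < x ∧ x < (r x).1 ∧
      ∀ s ∈ S, ¬ ((l x).1 < s.1 ∧ s.1 < (r x).1) := by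
    intro x hx
    have h1 := lt_of_le_of_ne (hlx x) (hx _ (hlS x))
    have h2 := lt_of_le_of_ne (hrx x) (hx _ (hrS x)).symm
    refine ⟨h1, h2, fun s hs h => ?_⟩
    rcases le_total s.1 x with h3 | h3
    · exact absurd (hlmax x s hs h3) (not_le.2 h.1)
    · exact absurd (hrmin x s hs h3) (not_le.2 h.2)
  have hbetween : ∀ x, (∀ p ∈ S, p.1 ≠ x) → (l x).2 < F x ∧ F x < (r x).2 := by
    intro x hx
    obtain ⟨h1, h2, -⟩ := hnS x hx
    have h3 : (l x).2 < (r x).2 := (hmono _ (hlS x) _ (hrS x)).1 (h1.trans h2)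
    have h4 : 0 < (x - (l x).1) / ((r x).1 - (l x).1) := div_pos (by linarith) (by linarith)
    have h5 : (x - (l x).1) / ((r x).1 - (l x).1) < 1 := by
      rw [div_lt_one (by linarith)]; linarith
    rw [hF]
    constructor <;> nlinarith
  have hle : ∀ p ∈ S, ∀ q ∈ S, p.1 ≤ q.1 → p.2 ≤ q.2 := fun p hp q hq h =>
    not_lt.1 fun h' => absurd ((hmono q hq p hp).2 h') (not_lt.2 h)
  have hlt1 : ∀ p ∈ S, ∀ x, x < p.1 → F x < p.2 := by
    intro p hp x hx
    by_cases h : ∃ s ∈ S, s.1 = x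
    · obtain ⟨s, hs, rfl⟩ := h
      rw [hFS s hs]; exact (hmono s hs p hp).1 hx
    · push Not at h
      exact (hbetween x h).2.trans_le (hle _ (hrS x) p hp (hrmin x p hp hx.le))
  have hlt2 : ∀ p ∈ S, ∀ x, p.1 < x → p.2 < F x := by
    intro p hp x hx
    by_cases h : ∃ s ∈ S, s.1 = x
    · obtain ⟨s, hs, rfl⟩ := h
      rw [hFS s hs]; exact (hmono p hp s hs).1 hx
    · push Not at h
      exact (hle p hp _ (hlS x) (hlmax x p hp hx.le)).trans_lt (hbetween x h).1
  have hFmono : StrictMono F := by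
    intro x y hxy
    by_cases h : ∃ p ∈ S, x ≤ p.1 ∧ p.1 ≤ y
    · obtain ⟨p, hp, hxp, hpy⟩ := h
      rcases hxp.lt_or_eq with h1 | h1
      · refine (hlt1 p hp x h1).trans_le ?_
        rcases hpy.lt_or_eq with h2 | h2
        · exact (hlt2 p hp y h2).le
        · rw [← h2, hFS p hp]
      · rw [h1, hFS p hp]
        exact hlt2 p hp y (h1 ▸ hxy)
    · push Not at h
      have hx : ∀ p ∈ S, p.1 ≠ x := fun p hp hpx =>
        absurd (h p hp hpx.ge) (not_lt.2 (hpx ▸ hxy.le))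
      obtain ⟨h1, h2, h3⟩ := hnS x hx
      have hy : y < (r x).1 := h _ (hrS x) h2.le
      have h4 : (l x).2 < (r x).2 := (hmono _ (hlS x) _ (hrS x)).1 (h1.trans h2)
      rw [hgap _ (hlS x) _ (hrS x) h3 x h1 h2, hgap _ (hlS x) _ (hrS x) h3 y (h1.trans hxy) hy]
      have h5 : (x - (l x).1) / ((r x).1 - (l x).1) < (y - (l x).1) / ((r x).1 - (l x).1) :=
        div_lt_div_of_pos_right (by linarith) (by linarith)
      nlinarith
  have hFsurj : Function.Surjective F := by
    intro z
    obtain ⟨⟨p, hp, hpz, hpmax⟩, q, hq, hzq, hqmin⟩ := key Prod.snd hc₂ hub₂ hlb₂ z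
    rcases hpz.lt_or_eq with h1 | h1
    swap
    · exact ⟨p.1, by rw [hFS p hp, h1]⟩
    rcases hzq.lt_or_eq with h2 | h2
    swap
    · exact ⟨q.1, by rw [hFS q hq, h2]⟩
    have h3 : p.1 < q.1 := (hmono p hp q hq).2 (h1.trans h2)
    have hn : ∀ s ∈ S, ¬ (p.1 < s.1 ∧ s.1 < q.1) := by
      intro s hs h
      have h4 := (hmono p hp s hs).1 h.1
      have h5 := (hmono s hs q hq).1 h.2
      rcases le_total s.2 z with h6 | h6
      · exact absurd (hpmax s hs h6) (not_le.2 h4)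
      · exact absurd (hqmin s hs h6) (not_le.2 h5)
    have ht0 : 0 < (z - p.2) / (q.2 - p.2) := div_pos (by linarith) (by linarith)
    have ht1 : (z - p.2) / (q.2 - p.2) < 1 := by rw [div_lt_one (by linarith)]; linarith
    refine ⟨p.1 + (q.1 - p.1) * ((z - p.2) / (q.2 - p.2)), ?_⟩
    rw [hgap p hp q hq hn _ (by nlinarith) (by nlinarith)]
    have h6 : q.2 - p.2 ≠ 0 := by linarith
    have h7 : q.1 - p.1 ≠ 0 := by linarith
    field_simp
    ring
  exact ⟨hFmono.orderIsoOfSurjective F hFsurj, fun p hp => hFS p hp⟩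

/-- A variant of `exists_orderIso_of_monotone_relation` for relations that may be bounded above:
a bounded relation is first prolonged by a translation on a half-line. -/
theorem exists_orderIso_of_monotone_relation' (S : Set (ℝ × ℝ))
    (hmono : ∀ p ∈ S, ∀ q ∈ S, p.1 < q.1 ↔ p.2 < q.2)
    (hc₁ : IsClosed (Prod.fst '' S)) (hc₂ : IsClosed (Prod.snd '' S))
    (hlb₁ : ∀ b, ∃ p ∈ S, p.1 ≤ b) (hlb₂ : ∀ b, ∃ p ∈ S, p.2 ≤ b)
    (hub : BddAbove (Prod.fst '' S) ↔ BddAbove (Prod.snd '' S)) :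
    ∃ e : ℝ ≃o ℝ, ∀ p ∈ S, e p.1 = p.2 := by
  by_cases hb : BddAbove (Prod.fst '' S)
  swap
  · refine exists_orderIso_of_monotone_relation S hmono hc₁ hc₂ (fun b => ?_) hlb₁
      (fun b => ?_) hlb₂
    · rw [not_bddAbove_iff] at hb
      obtain ⟨_, ⟨p, hp, rfl⟩, h⟩ := hb b
      exact ⟨p, hp, h.le⟩
    · rw [hub, not_bddAbove_iff] at hb
      obtain ⟨_, ⟨p, hp, rfl⟩, h⟩ := hb b
      exact ⟨p, hp, h.le⟩
  obtain ⟨p₀, hp₀, -⟩ := hlb₁ 0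
  obtain ⟨m, hm, hme⟩ := hc₁.csSup_mem ⟨_, p₀, hp₀, rfl⟩ hb
  have hmax₁ : ∀ p ∈ S, p.1 ≤ m.1 := fun p hp => hme ▸ le_csSup hb ⟨p, hp, rfl⟩
  have hmax₂ : ∀ p ∈ S, p.2 ≤ m.2 := fun p hp => not_lt.1 fun h =>
    absurd ((hmono m hm p hp).2 h) (not_lt.2 (hmax₁ p hp))
  have hlt : ∀ p ∈ S, p.1 < m.1 ↔ p.2 < m.2 := fun p hp => hmono p hp m hm
  let T : Set (ℝ × ℝ) := S ∪ (fun t : ℝ => (m.1 + t, m.2 + t)) '' Set.Ici 0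
  have hray : ∀ c : ℝ, (fun t : ℝ => c + t) '' Set.Ici 0 = Set.Ici c := by
    intro c; simp
  suffices h : ∃ e : ℝ ≃o ℝ, ∀ p ∈ T, e p.1 = p.2 from
    h.imp fun e he p hp => he p (Or.inl hp)
  refine exists_orderIso_of_monotone_relation T ?_ ?_ ?_ ?_ ?_ ?_ ?_
  · rintro p (hp | ⟨s, hs, rfl⟩) q (hq | ⟨t, ht, rfl⟩)
    · exact hmono p hp q hq
    · have h1 := hmax₁ p hp
      have h2 := hmax₂ p hp
      have h3 := hlt p hp
      simp only [Set.mem_Ici] at ht ⊢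
      rcases ht.lt_or_eq with h | h
      · constructor <;> intro <;> linarith
      · subst h; simpa using h3
    · have h1 := hmax₁ q hq
      have h2 := hmax₂ q hq
      simp only [Set.mem_Ici] at hs ⊢
      constructor <;> intro h <;> linarith
    · simp
  · rw [Set.image_union, Set.image_image]
    exact hc₁.union (by simpa only [hray] using isClosed_Ici)
  · rw [Set.image_union, Set.image_image]
    exact hc₂.union (by simpa only [hray] using isClosed_Ici)
  · intro b
    refine ⟨(m.1 + max 0 (b - m.1), m.2 + max 0 (b - m.1)),
      Or.inr ⟨_, Set.mem_Ici.2 (le_max_left _ _), rfl⟩, ?_⟩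
    have := le_max_right 0 (b - m.1)
    simp only; linarith
  · intro b
    obtain ⟨p, hp, h⟩ := hlb₁ b
    exact ⟨p, Or.inl hp, h⟩
  · intro b
    refine ⟨(m.1 + max 0 (b - m.2), m.2 + max 0 (b - m.2)),
      Or.inr ⟨_, Set.mem_Ici.2 (le_max_left _ _), rfl⟩, ?_⟩
    have := le_max_right 0 (b - m.2)
    simp only; linarith
  · intro b
    obtain ⟨p, hp, h⟩ := hlb₂ b
    exact ⟨p, Or.inl hp, h⟩

/-! ### Chains: prescribing an orbit near `+∞` -/

/-- The homeomorphism attached to a letter of the alphabet of the free group. -/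
def letterMap {ι : Type*} (a : ι → ℝ ≃o ℝ) (l : ι × Bool) : ℝ ≃o ℝ :=
  cond l.2 (a l.1) (a l.1)⁻¹

/-- The graphs of `a i` and `a' i` agree inside the quadrant `(-∞, M] × (-∞, M]`. -/
def AgreeBelow {ι : Type*} (M : ℝ) (a a' : ι → ℝ ≃o ℝ) : Prop :=
  ∀ i x, x ≤ M → a i x ≤ M → a' i x = a i x

theorem strictMono_of_succ_eq {M : ℝ} {u : ℕ → ℝ} (hu0 : u 0 ≤ M)
    (hu : ∀ j : ℕ, u (j + 1) = M + (j + 1)) : StrictMono u := by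
  refine strictMono_nat_of_lt_succ fun j => ?_
  rcases j with _ | j
  · rw [hu]; push_cast; linarith
  · rw [hu, hu]; push_cast; linarith

theorem isClosed_range_of_le {J : Set ℕ} {c : ℕ → ℝ} {b : ℝ} (h : ∀ j, b + j ≤ c j) :
    IsClosed (c '' J) := by
  have h1 : c '' J = ⋃ j : J, {c j} := by
    ext x
    simp [eq_comm]
  rw [h1]
  refine LocallyFinite.isClosed_iUnion (fun x => ?_) (fun j => isClosed_singleton)
  refine ⟨Set.Iio (x + 1), Iio_mem_nhds (by linarith), ?_⟩
  refine ((Set.finite_le_nat ⌈x + 1 - b⌉₊).preimage Subtype.val_injective.injOn).subset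
    fun j hj => ?_
  obtain ⟨y, hy1, hy2⟩ := hj
  have h2 := h j
  rw [Set.mem_Iio, Set.mem_singleton_iff.1 hy1] at hy2
  have h3 : ((j : ℕ) : ℝ) ≤ x + 1 - b := by linarith
  exact Nat.cast_le.1 (h3.trans (Nat.le_ceil _))

/-- **Chains.** The generators can be changed outside of the quadrant `(-∞, M]²` so that the
letters of a reduced infinite word move `u 0 < u 1 < u 2 < ⋯` step by step, provided that the first
step leaves `(-∞, M]`.  The prescribed values are monotone because two consecutive letters never
cancel. -/
theorem exists_chain {ι : Type*} (a : ι → ℝ ≃o ℝ) (M : ℝ) (u : ℕ → ℝ) (hu0 : u 0 ≤ M)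
    (hu : ∀ j : ℕ, u (j + 1) = M + (j + 1)) (l : ℕ → ι × Bool)
    (hred : ∀ j, (l j).1 = (l (j + 1)).1 → (l j).2 = (l (j + 1)).2)
    (h0 : M < (letterMap a (l 0))⁻¹ (u 0)) :
    ∃ a' : ι → ℝ ≃o ℝ, AgreeBelow M a a' ∧ ∀ j, letterMap a' (l j) (u (j + 1)) = u j := by
  have hmu := strictMono_of_succ_eq hu0 hu
  -- The point that the `j`-th step of the chain puts on the graph of the generator of `l j`.
  let c : ℕ → ℝ × ℝ := fun j => if (l j).2 then (u (j + 1), u j) else (u j, u (j + 1))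
  have hc : ∀ j k, j < k → (l j).1 = (l k).1 → (c j).1 < (c k).1 ∧ (c j).2 < (c k).2 := by
    intro j k hjk hl
    -- Letters of the same generator with opposite exponents are not consecutive.
    have hlt : (l j).2 ≠ (l k).2 → u (j + 1) < u k := by
      intro h
      refine hmu (lt_of_le_of_ne hjk ?_)
      rintro rfl
      exact h (hred j hl)
    have h1 : u (j + 1) < u (k + 1) := hmu (by lia)
    have h2 : u j < u k := hmu hjk
    have h3 : u j < u (k + 1) := hmu (by lia)
    rcases hj : (l j).2 <;> rcases hk : (l k).2 <;> simp only [hj, hk] at hlt <;>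
      simp [c, hj, hk, h1, h2, h3, hlt]
  have hcu : ∀ j, u 0 - 1 + j ≤ (c j).1 ∧ u 0 - 1 + j ≤ (c j).2 := by
    have h1 : ∀ j : ℕ, u 0 - 1 + j ≤ u j := by
      intro j
      rcases j with _ | j
      · simp
      · rw [hu]; push_cast; linarith
    intro j
    have h2 := h1 j
    have h3 := h1 (j + 1)
    push_cast at h3
    by_cases h : (l j).2 = true
    · simp only [c, h, if_true]; constructor <;> linarith
    · simp only [c, h]; constructor <;> simp <;> linarith
  have hcd : ∀ j, (c j).1 ≤ (c j).2 + (M + 1 - u 0) ∧ (c j).2 ≤ (c j).1 + (M + 1 - u 0) := by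
    have h1 : ∀ j : ℕ, u (j + 1) ≤ u j + (M + 1 - u 0) := by
      intro j
      rcases j with _ | j
      · rw [hu]; push_cast; linarith
      · rw [hu, hu]; push_cast; linarith
    intro j
    have h2 := h1 j
    have h3 : u j < u (j + 1) := hmu (by lia)
    by_cases h : (l j).2 = true
    · simp only [c, h, if_true]; constructor <;> linarith
    · simp only [c, h]; constructor <;> simp <;> linarith
  have key : ∀ i, ∃ e : ℝ ≃o ℝ, (∀ x, x ≤ M → a i x ≤ M → e x = a i x) ∧
      ∀ j, (l j).1 = i → e (c j).1 = (c j).2 := by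
    intro i
    -- The part of the graph of `a i` that is kept, and the prescribed values.
    let S₀ : Set (ℝ × ℝ) := (fun x => (x, a i x)) '' (Set.Iic M ∩ a i ⁻¹' Set.Iic M)
    let S₁ : Set (ℝ × ℝ) := c '' {j | (l j).1 = i}
    have h01 : ∀ p ∈ S₀, ∀ q ∈ S₁, p.1 < q.1 ∧ p.2 < q.2 := by
      rintro _ ⟨x, ⟨hx1, hx2⟩, rfl⟩ _ ⟨j, hj, rfl⟩
      simp only [Set.mem_Iic, Set.mem_preimage, Set.mem_ofPred_eq] at hx1 hx2 hj
      have hM1 : ∀ j, M < u (j + 1) := fun j => by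
        rw [hu]
        have : (0 : ℝ) ≤ j := Nat.cast_nonneg j
        linarith
      rcases j with _ | j
      · simp only [letterMap] at h0
        rw [hj] at h0
        have h1 := hM1 0
        rcases hb : (l 0).2
        · simp only [hb, cond_false, inv_inv] at h0
          simp only [c, hb]
          refine ⟨?_, hx2.trans_lt h1⟩
          by_contra h
          simp only [Bool.false_eq_true, if_false, not_lt] at h
          exact absurd ((a i).monotone h) (not_le.2 (hx2.trans_lt h0))
        · simp only [hb, cond_true] at h0
          simp only [c, hb, if_true]
          refine ⟨hx1.trans_lt h1, ?_⟩
          have := (a i).strictMono (hx1.trans_lt h0)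
          rwa [RelIso.apply_inv_self] at this
      · have h1 := hM1 j
        have h2 := hM1 (j + 1)
        rcases hb : (l (j + 1)).2 <;> simp only [c, hb] <;> constructor <;> simp <;> linarith
    have h11 : ∀ p ∈ S₁, ∀ q ∈ S₁, p.1 < q.1 ↔ p.2 < q.2 := by
      rintro _ ⟨j, hj, rfl⟩ _ ⟨k, hk, rfl⟩
      rcases lt_trichotomy j k with h | rfl | h
      · have := hc j k h (hj.trans hk.symm)
        exact iff_of_true this.1 this.2
      · simp
      · have := hc k j h (hk.trans hj.symm)
        exact iff_of_false this.1.not_gt this.2.not_gt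
    suffices h : ∃ e : ℝ ≃o ℝ, ∀ p ∈ S₀ ∪ S₁, e p.1 = p.2 from
      h.imp fun e he => ⟨fun x hx hax => he (x, a i x) (Or.inl ⟨x, ⟨hx, hax⟩, rfl⟩),
        fun j hj => he (c j) (Or.inr ⟨j, hj, rfl⟩)⟩
    refine exists_orderIso_of_monotone_relation' (S₀ ∪ S₁) ?_ ?_ ?_ ?_ ?_ ?_
    · rintro p (hp | hp) q (hq | hq)
      · obtain ⟨x, -, rfl⟩ := hp
        obtain ⟨y, -, rfl⟩ := hq
        exact (a i).lt_iff_lt.symm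
      · have := h01 p hp q hq
        exact iff_of_true this.1 this.2
      · have := h01 q hq p hp
        exact iff_of_false this.1.not_gt this.2.not_gt
      · exact h11 p hp q hq
    · rw [Set.image_union, Set.image_image, Set.image_image]
      refine IsClosed.union ?_ (isClosed_range_of_le fun j => (hcu j).1)
      simp only [Set.image_id']
      exact isClosed_Iic.inter (isClosed_Iic.preimage (a i).continuous)
    · rw [Set.image_union, Set.image_image, Set.image_image]
      refine IsClosed.union ?_ (isClosed_range_of_le fun j => (hcu j).2)
      exact (a i).toHomeomorph.isClosedMap _
        (isClosed_Iic.inter (isClosed_Iic.preimage (a i).continuous))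
    · intro b
      refine ⟨_, Or.inl ⟨min b (min M ((a i).symm M)), ⟨?_, ?_⟩, rfl⟩, ?_⟩
      · simp
      · simp only [Set.mem_preimage, Set.mem_Iic]
        rw [← OrderIso.le_symm_apply]; simp
      · simp
    · intro b
      refine ⟨_, Or.inl ⟨min M ((a i).symm (min b M)), ⟨?_, ?_⟩, rfl⟩, ?_⟩
      · simp
      · simp only [Set.mem_preimage, Set.mem_Iic]
        rw [← OrderIso.le_symm_apply]
        exact (min_le_right _ _).trans ((a i).symm.monotone (min_le_right _ _))
      · simp only
        rw [← OrderIso.le_symm_apply]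
        exact (min_le_right _ _).trans ((a i).symm.monotone (min_le_left _ _))
    · constructor
      · rintro ⟨B, hB⟩
        refine ⟨max M (B + (M + 1 - u 0)), ?_⟩
        rintro _ ⟨p, (⟨x, hx, rfl⟩ | ⟨j, hj, rfl⟩), rfl⟩
        · exact hx.2.trans (le_max_left _ _)
        · have h1 := hB ⟨c j, Or.inr ⟨j, hj, rfl⟩, rfl⟩
          exact le_max_of_le_right (by linarith [hcd j])
      · rintro ⟨B, hB⟩
        refine ⟨max M (B + (M + 1 - u 0)), ?_⟩
        rintro _ ⟨p, (⟨x, hx, rfl⟩ | ⟨j, hj, rfl⟩), rfl⟩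
        · exact hx.1.trans (le_max_left _ _)
        · have h1 := hB ⟨c j, Or.inr ⟨j, hj, rfl⟩, rfl⟩
          exact le_max_of_le_right (by linarith [hcd j])
  choose a' ha' hac using key
  refine ⟨a', ha', fun j => ?_⟩
  have h := hac (l j).1 j rfl
  unfold letterMap
  rcases hb : (l j).2
  · simp only [c, hb] at h
    simp only [Bool.false_eq_true, if_false] at h
    rw [cond_false, ← h, RelIso.inv_apply_self]
  · simp only [c, hb, if_true] at h
    rw [cond_true, h]

/-! ### Words along chains -/

theorem AgreeBelow.mono {ι : Type*} {K M : ℝ} {a a' : ι → ℝ ≃o ℝ} (h : AgreeBelow M a a')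
    (hKM : K ≤ M) : AgreeBelow K a a' :=
  fun i x hx hax => h i x (hx.trans hKM) (hax.trans hKM)

theorem AgreeBelow.symm {ι : Type*} {M : ℝ} {a a' : ι → ℝ ≃o ℝ} (h : AgreeBelow M a a') :
    AgreeBelow M a' a := by
  intro i x hx hax
  by_contra hne
  have h1 : M < a i x := by
    by_contra h2
    exact hne (h i x hx (not_lt.1 h2)).symm
  have h2 : (a i).symm M < x := by rwa [OrderIso.symm_apply_lt]
  have h3 : a' i ((a i).symm M) = M := by
    rw [h i _ (h2.le.trans hx) (by simp)]; simp
  have h4 : a' i ((a i).symm M) < a' i x := (a' i).strictMono h2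
  rw [h3] at h4
  exact absurd hax (not_le.2 h4)

theorem AgreeBelow.letterMap_eq {ι : Type*} {M : ℝ} {a a' : ι → ℝ ≃o ℝ} (h : AgreeBelow M a a')
    (l : ι × Bool) {x : ℝ} (hx : x ≤ M) (hax : letterMap a l x ≤ M) :
    letterMap a' l x = letterMap a l x := by
  obtain ⟨i, b⟩ := l
  rcases b
  · change (a' i)⁻¹ x = (a i)⁻¹ x
    change (a i)⁻¹ x ≤ M at hax
    have h1 : a i ((a i)⁻¹ x) = x := RelIso.apply_inv_self _ _
    have h2 := h i _ hax (h1.trans_le hx)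
    rw [h1] at h2
    nth_rewrite 1 [← h2]
    exact RelIso.inv_apply_self _ _
  · exact h i x hx hax

theorem AgreeBelow.fixed {ι : Type*} {M x : ℝ} {a a' : ι → ℝ ≃o ℝ} (h : AgreeBelow M a a')
    (hx : x ≤ M) (hfix : ∀ i, a' i x = x) (i : ι) : a i x = x := by
  have h1 := h.symm i x hx ((hfix i).trans_le hx)
  rw [h1, hfix i]

theorem inv_apply_eq_iff {e : ℝ ≃o ℝ} {x y : ℝ} : e⁻¹ x = y ↔ x = e y :=
  ⟨fun h => by rw [← h, RelIso.apply_inv_self], fun h => by rw [h, RelIso.inv_apply_self]⟩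

theorem letterMap_fixed {ι : Type*} {a : ι → ℝ ≃o ℝ} {x : ℝ} (h : ∀ i, a i x = x) (l : ι × Bool) :
    letterMap a l x = x := by
  obtain ⟨i, b⟩ := l
  rcases b
  · exact inv_apply_eq_iff.2 (h i).symm
  · exact h i

theorem lift_fixed {ι : Type*} {a : ι → ℝ ≃o ℝ} {x : ℝ} (h : ∀ i, a i x = x) (g : FreeGroup ι) :
    FreeGroup.lift a g x = x := by
  induction g using FreeGroup.induction_on with
  | C1 => simp
  | of i => simpa using h i
  | inv_of i ih => rw [_root_.map_inv]; exact inv_apply_eq_iff.2 ih.symm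
  | mul g k hg hk => rw [map_mul, RelIso.mul_apply, hk, hg]

theorem lift_mk_cons {ι : Type*} (a : ι → ℝ ≃o ℝ) (l : ι × Bool) (L : List (ι × Bool)) :
    FreeGroup.lift a (FreeGroup.mk (l :: L)) =
      letterMap a l * FreeGroup.lift a (FreeGroup.mk L) := by
  simp [FreeGroup.lift_mk, letterMap]

/-- If the letters of a word move the points of a sequence back by one step, the word moves them
back by its length. -/
theorem lift_mk_chain {ι : Type*} (a : ι → ℝ ≃o ℝ) (u : ℕ → ℝ) (L : List (ι × Bool)) (r : ℕ)
    (h : ∀ (i : ℕ) (hi : i < L.length), letterMap a L[i] (u (r + i + 1)) = u (r + i)) :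
    FreeGroup.lift a (FreeGroup.mk L) (u (r + L.length)) = u r := by
  induction L generalizing r with
  | nil => simp [FreeGroup.lift_mk]
  | cons l L ih =>
    have h0 := h 0 (by simp)
    have h1 := ih (r + 1) fun i hi => by
      have := h (i + 1) (by simpa using hi)
      simpa [add_assoc, add_comm, add_left_comm] using this
    rw [lift_mk_cons, RelIso.mul_apply, List.length_cons]
    have h2 : r + (L.length + 1) = r + 1 + L.length := by lia
    rw [h2, h1]
    simpa using h0

/-- The periodic infinite word `L L L ⋯`. -/
def periodicWord {ι : Type*} (L : List (ι × Bool)) (hL : L ≠ []) (j : ℕ) : ι × Bool :=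
  L[j % L.length]'(Nat.mod_lt _ (List.length_pos_iff.2 hL))

/-- Consecutive letters of the periodic word of a cyclically reduced word never cancel. -/
theorem periodicWord_reduced {ι : Type*} {L : List (ι × Bool)} (hL : L ≠ [])
    (h : FreeGroup.IsCyclicallyReduced L) (j : ℕ) :
    (periodicWord L hL j).1 = (periodicWord L hL (j + 1)).1 →
      (periodicWord L hL j).2 = (periodicWord L hL (j + 1)).2 := by
  have hk : 0 < L.length := List.length_pos_iff.2 hL
  have hj := Nat.mod_lt j hk
  unfold periodicWord
  by_cases hlast : j % L.length + 1 = L.length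
  · have h1 : (j + 1) % L.length = 0 := by
      rw [← Nat.mod_add_mod, hlast, Nat.mod_self]
    have h2 : j % L.length = L.length - 1 := by lia
    simp only [h1, h2]
    refine h.2 _ ?_ _ ?_
    · simp [List.getLast?_eq_getElem?, hk]
    · simp [List.head?_eq_getElem?, hk]
  · have h1 : (j + 1) % L.length = j % L.length + 1 := by
      rw [← Nat.mod_add_mod, Nat.mod_eq_of_lt (by lia)]
    simp only [h1]
    exact List.isChain_iff_getElem.1 h.1 _ (by lia)

theorem lift_mk_inv_pow_chain {ι : Type*} (a : ι → ℝ ≃o ℝ) (u : ℕ → ℝ) (L : List (ι × Bool))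
    (hL : L ≠ []) (r : ℕ)
    (h : ∀ j, letterMap a (periodicWord L hL j) (u (r + j + 1)) = u (r + j)) (t : ℕ) :
    ((FreeGroup.lift a (FreeGroup.mk L))⁻¹ ^ t) (u r) = u (r + t * L.length) := by
  induction t with
  | zero => simp
  | succ t ih =>
    rw [pow_succ', RelIso.mul_apply, ih, inv_apply_eq_iff]
    have h1 := lift_mk_chain a u L (r + t * L.length) fun i hi => by
      have := h (t * L.length + i)
      unfold periodicWord at this
      simp only [Nat.mul_add_mod_self_right, Nat.mod_eq_of_lt hi] at this
      simpa [add_assoc] using this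
    rw [← h1]
    congr 2
    ring

/-- Along an orbit which stays in `(-∞, M]`, a word depends only on the generators inside the
quadrant `(-∞, M]²`. -/
theorem AgreeBelow.lift_inv_eq {ι : Type*} {M : ℝ} {a a' : ι → ℝ ≃o ℝ} (h : AgreeBelow M a a')
    (L : List (ι × Bool)) (v : ℕ → ℝ) (r : ℕ)
    (hv : ∀ (i : ℕ) (hi : i < L.length), letterMap a L[i] (v (r + i + 1)) = v (r + i))
    (hM : ∀ i ≤ L.length, v (r + i) ≤ M) {x : ℝ} (hx : x ≤ v r) :
    (FreeGroup.lift a' (FreeGroup.mk L))⁻¹ x = (FreeGroup.lift a (FreeGroup.mk L))⁻¹ x := by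
  induction L generalizing r x with
  | nil => simp [FreeGroup.lift_mk]
  | cons l L ih =>
    rw [lift_mk_cons, lift_mk_cons, mul_inv_rev, mul_inv_rev, RelIso.mul_apply, RelIso.mul_apply]
    have h0 : letterMap a l (v (r + 1)) = v r := hv 0 (by simp)
    have hle : (letterMap a l)⁻¹ x ≤ v (r + 1) := by
      have := (letterMap a l)⁻¹.monotone hx
      rwa [← h0, RelIso.inv_apply_self] at this
    have hM1 : v (r + 1) ≤ M := hM 1 (by simp)
    have hxM : x ≤ M := hx.trans (by simpa using hM 0 (by simp))
    have h1 : (letterMap a' l)⁻¹ x = (letterMap a l)⁻¹ x := by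
      have := h.letterMap_eq l (x := (letterMap a l)⁻¹ x) (hle.trans hM1)
        (by rwa [RelIso.apply_inv_self])
      rw [RelIso.apply_inv_self] at this
      exact inv_apply_eq_iff.2 this.symm
    rw [h1]
    refine ih (r + 1) (fun i hi => ?_) (fun i hi => ?_) hle
    · have := hv (i + 1) (by simpa using hi)
      simpa [add_assoc, add_comm, add_left_comm] using this
    · have := hM (i + 1) (by simpa using hi)
      simpa [add_assoc, add_comm, add_left_comm] using this

/-- The orbit of `y` under the successive inverse letters of the periodic word `L L L ⋯`. -/
def wordOrbit {ι : Type*} (a : ι → ℝ ≃o ℝ) (L : List (ι × Bool)) (hL : L ≠ []) (y : ℝ) : ℕ → ℝ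
  | 0 => y
  | j + 1 => (letterMap a (periodicWord L hL j))⁻¹ (wordOrbit a L hL y j)

theorem letterMap_wordOrbit {ι : Type*} (a : ι → ℝ ≃o ℝ) (L : List (ι × Bool)) (hL : L ≠ [])
    (y : ℝ) (j : ℕ) : letterMap a (periodicWord L hL j) (wordOrbit a L hL y (j + 1)) =
      wordOrbit a L hL y j :=
  RelIso.apply_inv_self _ _

theorem letterMap_wordOrbit_getElem {ι : Type*} (a : ι → ℝ ≃o ℝ) (L : List (ι × Bool))
    (hL : L ≠ []) (y : ℝ) (i : ℕ) (hi : i < L.length) :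
    letterMap a L[i] (wordOrbit a L hL y (0 + i + 1)) = wordOrbit a L hL y (0 + i) := by
  have h := letterMap_wordOrbit a L hL y i
  unfold periodicWord at h
  simp only [Nat.mod_eq_of_lt hi] at h
  simpa using h

/-- The height `M` reached by the orbit of `y` under the successive inverse letters of `L`: the
inverse of the word `L` depends, on `(-∞, y]`, only on the generators inside `(-∞, M]²`, and a
point of `(y, M]` is never fixed by all generators. -/
theorem exists_height {ι : Type*} (a : ι → ℝ ≃o ℝ) (L : List (ι × Bool)) (hL : L ≠ []) (y : ℝ) :
    ∃ M, y ≤ M ∧ (∀ j ≤ L.length, wordOrbit a L hL y j ≤ M) ∧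
      (∃ j ≤ L.length, wordOrbit a L hL y j = M) ∧
      (∀ a', AgreeBelow M a a' → ∀ x ≤ y,
        (FreeGroup.lift a' (FreeGroup.mk L))⁻¹ x = (FreeGroup.lift a (FreeGroup.mk L))⁻¹ x) ∧
      ∀ x, y < x → (∀ i, a i x = x) → M < x := by
  obtain ⟨j, hj, hmax⟩ := Finset.exists_max_image (Finset.range (L.length + 1))
    (wordOrbit a L hL y) ⟨0, by simp⟩
  have hmax' : ∀ i ≤ L.length, wordOrbit a L hL y i ≤ wordOrbit a L hL y j :=
    fun i hi => hmax i (by simpa [Nat.lt_succ_iff] using hi)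
  refine ⟨wordOrbit a L hL y j, hmax' 0 (by simp), hmax', ⟨j, ?_, rfl⟩, ?_, ?_⟩
  · simpa [Nat.lt_succ_iff] using hj
  · intro a' h x hx
    refine h.lift_inv_eq L (wordOrbit a L hL y) 0 (letterMap_wordOrbit_getElem a L hL y) ?_ hx
    simpa using hmax'
  · intro x hyx hx
    have : ∀ i, wordOrbit a L hL y i < x := by
      intro i
      induction i with
      | zero => exact hyx
      | succ i ih =>
        have h1 := (letterMap a (periodicWord L hL i))⁻¹.strictMono ih
        rwa [inv_apply_eq_iff.2 (letterMap_fixed hx _).symm] at h1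
    exact this j

open Filter in
/-- If the inverse of a cyclically reduced word moves `y` upwards, then the generators can be
changed near `+∞` so that the orbit of `y` escapes to `+∞`. -/
theorem exists_escape_of_lt {ι : Type*} (a : ι → ℝ ≃o ℝ) (L : List (ι × Bool)) (hL : L ≠ [])
    (hred : FreeGroup.IsCyclicallyReduced L) (y : ℝ)
    (hy : y < (FreeGroup.lift a (FreeGroup.mk L))⁻¹ y) :
    ∃ M, y ≤ M ∧ ∃ a', AgreeBelow M a a' ∧
      (∀ x ≤ y, (FreeGroup.lift a' (FreeGroup.mk L))⁻¹ x =
        (FreeGroup.lift a (FreeGroup.mk L))⁻¹ x) ∧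
      Tendsto (fun t : ℕ => ((FreeGroup.lift a' (FreeGroup.mk L))⁻¹ ^ t) y) atTop atTop := by
  obtain ⟨M, hyM, hM, ⟨j₀, hj₀, hj₀M⟩, hagree, -⟩ := exists_height a L hL y
  have hk : 0 < L.length := List.length_pos_iff.2 hL
  set v := wordOrbit a L hL y with hv
  have hper : ∀ j, periodicWord L hL (j + L.length) = periodicWord L hL j := by
    intro j; simp [periodicWord]
  -- Since the inverse of the word moves `y` upwards, the orbit is higher after each turn.
  have hvk : v L.length = (FreeGroup.lift a (FreeGroup.mk L))⁻¹ y := by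
    have := lift_mk_chain a v L 0 (letterMap_wordOrbit_getElem a L hL y)
    rw [zero_add] at this
    exact (inv_apply_eq_iff.2 this.symm).symm
  have hup : ∀ j, v j < v (j + L.length) := by
    intro j
    induction j with
    | zero => rw [zero_add, hvk]; exact hy
    | succ j ih =>
      have h1 := (letterMap a (periodicWord L hL j))⁻¹.strictMono ih
      rw [show j + 1 + L.length = (j + L.length) + 1 by lia]
      rw [hv] at h1 ⊢
      simp only [wordOrbit, hper]
      exact h1
  have hex : ∃ j, M < v j := ⟨j₀ + L.length, hj₀M ▸ hup j₀⟩
  classical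
  -- The chain takes over where the orbit leaves `(-∞, M]` for the first time.
  obtain ⟨J, hJ⟩ : ∃ J, Nat.find hex = J + 1 := by
    refine Nat.exists_eq_succ_of_ne_zero fun h0 => ?_
    have := Nat.find_spec hex
    rw [h0] at this
    exact absurd hyM (not_le.2 this)
  have hJ1 : M < v (J + 1) := hJ ▸ Nat.find_spec hex
  have hJ2 : ∀ j ≤ J, v j ≤ M := fun j hj => not_lt.1 (Nat.find_min hex (by lia))
  obtain ⟨a', ha', hchain⟩ := exists_chain a M
    (fun i => if i = 0 then v J else M + i) (by simpa using hJ2 J le_rfl) (by intro j; simp)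
    (fun i => periodicWord L hL (J + i))
    (fun i => periodicWord_reduced hL hred (J + i)) (by
      change M < v (J + 1) at hJ1
      rw [hv] at hJ1 ⊢
      exact hJ1)
  refine ⟨M, hyM, a', ha', hagree a' ha', ?_⟩
  let u : ℕ → ℝ := fun i => if i ≤ J then v i else M + (i - J : ℝ)
  have hu : ∀ j, letterMap a' (periodicWord L hL j) (u (0 + j + 1)) = u (0 + j) := by
    intro j
    rw [zero_add]
    rcases lt_or_ge j J with h | h
    · have h1 : u (j + 1) = v (j + 1) := if_pos (by lia)
      have h2 : u j = v j := if_pos h.le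
      have h3 : letterMap a (periodicWord L hL j) (v (j + 1)) = v j :=
        letterMap_wordOrbit a L hL y j
      rw [h1, h2, ha'.letterMap_eq _ (hJ2 _ (by lia)) (h3.trans_le (hJ2 _ h.le)), h3]
    · obtain ⟨i, rfl⟩ := Nat.exists_eq_add_of_le h
      have h1 := hchain i
      simp only [Nat.add_eq_zero_iff, one_ne_zero, and_false, if_false] at h1
      have h2 : u (J + i + 1) = M + ((i + 1 : ℕ) : ℝ) := by
        simp only [u]
        rw [if_neg (by lia)]
        push_cast; ring
      have h3 : u (J + i) = if i = 0 then v J else M + (i : ℝ) := by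
        simp only [u]
        rcases i with _ | i
        · simp
        · rw [if_neg (by lia), if_neg (by lia)]
          push_cast; ring
      rw [h2, h3]
      exact h1
  have hpow := lift_mk_inv_pow_chain a' u L hL 0 hu
  have hu0 : u 0 = y := if_pos (Nat.zero_le J)
  rw [hu0] at hpow
  simp only [zero_add] at hpow
  simp only [hpow]
  have hu_top : Tendsto u atTop atTop := by
    have h1 : Tendsto (fun i : ℕ => M + ((i : ℝ) - J)) atTop atTop :=
      tendsto_atTop_add_const_left _ _
        (tendsto_atTop_add_const_right _ _ tendsto_natCast_atTop_atTop)
    refine h1.congr' ?_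
    filter_upwards [eventually_gt_atTop J] with i hi
    simp only [u]
    rw [if_neg (by lia)]
  exact hu_top.comp (tendsto_id.atTop_mul_const' hk)

open Filter in
/-- The generators of a free group of rank at least two can be changed near `+∞` so that there is
no global fixed point on `[M, ∞)` and some orbit of the inverse of a given cyclically reduced word
escapes to `+∞`.  The chain starts with a letter moving `M` upwards, followed by a letter
which prevents cancellation with the given word. -/
theorem exists_fixedPointFree_escape {ι : Type*} [Nontrivial ι] (a : ι → ℝ ≃o ℝ) (M : ℝ)
    (hM : ∃ i, a i M ≠ M) (L : List (ι × Bool)) (hL : L ≠ [])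
    (hred : FreeGroup.IsCyclicallyReduced L) :
    ∃ a', AgreeBelow M a a' ∧ (∀ x, M ≤ x → ∃ i, a' i x ≠ x) ∧
      ∃ z, Tendsto (fun t : ℕ => ((FreeGroup.lift a' (FreeGroup.mk L))⁻¹ ^ t) z) atTop atTop := by
  have hk : 0 < L.length := List.length_pos_iff.2 hL
  obtain ⟨l₀, hl₀⟩ : ∃ l, M < (letterMap a l)⁻¹ M := by
    obtain ⟨i, hi⟩ := hM
    rcases hi.lt_or_gt with h | h
    · refine ⟨(i, true), ?_⟩
      have := (a i)⁻¹.strictMono h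
      rwa [RelIso.inv_apply_self] at this
    · exact ⟨(i, false), by simpa [letterMap] using h⟩
  obtain ⟨c, hc₁, hc₂⟩ : ∃ c : ι × Bool, (l₀.1 = c.1 → l₀.2 = c.2) ∧
      (c.1 = (periodicWord L hL 0).1 → c.2 = (periodicWord L hL 0).2) := by
    by_cases h : l₀.1 = (periodicWord L hL 0).1
    · obtain ⟨i, hi⟩ := exists_ne l₀.1
      exact ⟨(i, true), fun h' => absurd h'.symm hi, fun h' => absurd (h'.trans h.symm) hi⟩
    · exact ⟨l₀, fun _ => rfl, fun h' => absurd h' h⟩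
  let l : ℕ → ι × Bool := fun j => match j with
    | 0 => l₀
    | 1 => c
    | j + 2 => periodicWord L hL j
  have hl : ∀ j, (l j).1 = (l (j + 1)).1 → (l j).2 = (l (j + 1)).2 := by
    rintro (_ | _ | j)
    · exact hc₁
    · exact hc₂
    · exact periodicWord_reduced hL hred j
  obtain ⟨a', ha', hchain⟩ := exists_chain a M (fun j => M + j) (by simp) (by intro j; simp) l hl
    (by simpa [l] using hl₀)
  refine ⟨a', ha', fun x hx => ?_, M + 2, ?_⟩
  · by_contra! hfix
    have h1 := hchain ⌊x - M⌋₊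
    have h2 : x < M + ((⌊x - M⌋₊ + 1 : ℕ) : ℝ) := by
      have := Nat.lt_floor_add_one (x - M)
      push_cast; linarith
    have h3 : M + (⌊x - M⌋₊ : ℝ) ≤ x := by
      have := Nat.floor_le (sub_nonneg.2 hx)
      linarith
    have h4 := (letterMap a' (l ⌊x - M⌋₊)).strictMono h2
    rw [h1, letterMap_fixed hfix] at h4
    exact absurd h3 (not_le.2 h4)
  · have hpow := lift_mk_inv_pow_chain a' (fun j => M + j) L hL 2 fun j => by
      have := hchain (2 + j)
      rwa [show l (2 + j) = periodicWord L hL j by rw [add_comm]] at this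
    simp only [Nat.cast_ofNat] at hpow
    simp only [hpow]
    refine tendsto_atTop_add_const_left _ _ (tendsto_natCast_atTop_atTop.comp ?_)
    exact tendsto_atTop_mono (fun t => Nat.le_add_left _ _) (tendsto_id.atTop_mul_const' hk)

/-! ### Actions on the line -/

/-- An action of a group on the line by monotone maps, as a homomorphism. -/
def homOfMonotoneAction {H : Type*} [Group H] (F : H → ℝ → ℝ) (h1 : ∀ x, F 1 x = x)
    (hmul : ∀ g k x, F (g * k) x = F g (F k x)) (hmono : ∀ g, Monotone (F g)) : H →* (ℝ ≃o ℝ) where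
  toFun g :=
    { toFun := F g
      invFun := F g⁻¹
      left_inv := fun x => by rw [← hmul, inv_mul_cancel, h1]
      right_inv := fun x => by rw [← hmul, mul_inv_cancel, h1]
      map_rel_iff' := fun {x y} => by
        refine ⟨fun h => ?_, fun h => hmono g h⟩
        have := hmono g⁻¹ h
        simpa [← hmul, h1] using this }
  map_one' := by ext x; exact h1 x
  map_mul' g k := by ext x; exact hmul g k x

/-- An action on a lower set `D` and an action on its complement fit together. -/
theorem exists_glued_hom {H : Type*} [Group H] (D : Set ℝ) (hD : IsLowerSet D) (F E : H → ℝ → ℝ)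
    (hF1 : ∀ x ∈ D, F 1 x = x) (hFD : ∀ g, ∀ x ∈ D, F g x ∈ D)
    (hFmul : ∀ g k, ∀ x ∈ D, F (g * k) x = F g (F k x)) (hFmono : ∀ g, MonotoneOn (F g) D)
    (hE1 : ∀ x ∉ D, E 1 x = x) (hED : ∀ g, ∀ x ∉ D, E g x ∉ D)
    (hEmul : ∀ g k, ∀ x ∉ D, E (g * k) x = E g (E k x)) (hEmono : ∀ g, MonotoneOn (E g) Dᶜ) :
    ∃ σ : H →* (ℝ ≃o ℝ), (∀ g, ∀ x ∈ D, σ g x = F g x) ∧ ∀ g, ∀ x ∉ D, σ g x = E g x := by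
  classical
  refine ⟨homOfMonotoneAction (fun g x => if x ∈ D then F g x else E g x) ?_ ?_ ?_,
    fun g x hx => if_pos hx, fun g x hx => if_neg hx⟩
  · intro x
    by_cases hx : x ∈ D
    · simp [hx, hF1]
    · simp [hx, hE1]
  · intro g k x
    by_cases hx : x ∈ D
    · simp [hx, hFD, hFmul]
    · simp [hx, hED, hEmul]
  · intro g x y hxy
    by_cases hy : y ∈ D
    · have hx := hD hxy hy
      simpa [hx, hy] using hFmono g hx hy hxy
    · by_cases hx : x ∈ D
      · simp only [hx, hy, if_true, if_false]
        by_contra! h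
        exact hED g y hy (hD h.le (hFD g x hx))
      · simpa [hx, hy] using hEmono g hx hy hxy

open Filter in
/-- An increasing orbit of a continuous monotone map escapes to `+∞`, or its supremum is a fixed
point. -/
theorem tendsto_iterate_or_fixed {T : ℝ → ℝ} (hT : Continuous T) (hmono : Monotone T) {x : ℝ}
    (hx : x ≤ T x) : Tendsto (fun n => T^[n] x) atTop atTop ∨
      ∃ p, T p = p ∧ (∀ n, T^[n] x ≤ p) ∧ ∀ b, (∀ n, T^[n] x ≤ b) → p ≤ b := by
  have hm : Monotone fun n => T^[n] x := hmono.monotone_iterate_of_le_map hx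
  rcases tendsto_atTop_of_monotone hm with h | ⟨p, hp⟩
  · exact Or.inl h
  · refine Or.inr ⟨p, isFixedPt_of_tendsto_iterate hp hT.continuousAt,
      fun n => hm.ge_of_tendsto hp n, fun b hb => le_of_tendsto' hp hb⟩

theorem orderIso_pow_apply (f : ℝ ≃o ℝ) (n : ℕ) (x : ℝ) : (f ^ n) x = f^[n] x := by
  induction n with
  | zero => rfl
  | succ n ih => rw [pow_succ', RelIso.mul_apply, ih, Function.iterate_succ_apply']

theorem zpow_fixed {f : ℝ ≃o ℝ} {p : ℝ} (hp : f p = p) (n : ℤ) : (f ^ n) p = p := by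
  have hpow : ∀ n : ℕ, (f ^ n) p = p := fun n => by
    rw [orderIso_pow_apply]; exact Function.iterate_fixed hp n
  cases n with
  | ofNat n => exact hpow n
  | negSucc n => rw [zpow_negSucc, inv_apply_eq_iff, hpow]

/-! ### Charts conjugating a homeomorphism to a translation -/

/-- A chart of the connected component of `x₀` in the complement of the fixed points of `f`, when
`f` moves `x₀` up: affine from `[0, 1]` to `[x₀, f x₀]`, and extended by equivariance. -/
theorem exists_strictMono_chart (f : ℝ ≃o ℝ) (x₀ : ℝ) (hx₀ : x₀ < f x₀) :
    ∃ h : ℝ → ℝ, StrictMono h ∧ (∀ t, h (t + 1) = f (h t)) ∧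
      (∀ t p, f p = p → p ∉ Set.uIcc x₀ (h t)) ∧
      ∀ z, (∀ p ∈ Set.uIcc x₀ z, f p ≠ p) → z ∈ Set.range h := by
  set d := f x₀ - x₀ with hd
  have hd0 : 0 < d := sub_pos.2 hx₀
  have hzmono : StrictMono fun n : ℤ => (f ^ n) x₀ := by
    refine strictMono_int_of_lt_succ fun n => ?_
    rw [zpow_add_one, RelIso.mul_apply]
    exact (f ^ n).strictMono hx₀
  let h : ℝ → ℝ := fun t => (f ^ ⌊t⌋) (x₀ + Int.fract t * d)
  have hlow : ∀ t, (f ^ ⌊t⌋) x₀ ≤ h t := fun t => (f ^ ⌊t⌋).monotone <| by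
    have := mul_nonneg (Int.fract_nonneg t) hd0.le
    linarith
  have hhigh : ∀ t, h t < (f ^ (⌊t⌋ + 1)) x₀ := fun t => by
    rw [zpow_add_one, RelIso.mul_apply]
    refine (f ^ ⌊t⌋).strictMono ?_
    have := mul_lt_mul_of_pos_right (Int.fract_lt_one t) hd0
    linarith
  refine ⟨h, fun s t hst => ?_, fun t => ?_, fun t p hp hmem => ?_, fun z hz => ?_⟩
  · rcases (Int.floor_mono hst.le).lt_or_eq with h1 | h1
    · exact (hhigh s).trans_le ((hzmono.monotone (Int.add_one_le_of_lt h1)).trans (hlow t))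
    · simp only [h, h1]
      refine (f ^ ⌊t⌋).strictMono ?_
      have h2 : Int.fract s < Int.fract t := by
        unfold Int.fract; rw [h1]; linarith
      have := mul_lt_mul_of_pos_right h2 hd0
      linarith
  · simp only [h, Int.floor_add_one, Int.fract_add_one]
    rw [add_comm, zpow_add, zpow_one, RelIso.mul_apply]
  · have h1 : p ≠ x₀ := by rintro rfl; exact hx₀.ne' hp
    rcases h1.lt_or_gt with h2 | h2
    · have h3 : p < h t := by
        have := (f ^ ⌊t⌋).strictMono h2
        rw [zpow_fixed hp] at this
        exact this.trans_le (hlow t)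
      rcases Set.mem_uIcc.1 hmem with h4 | h4 <;> linarith
    · have h3 : h t < p := by
        have := (f ^ (⌊t⌋ + 1)).strictMono h2
        rw [zpow_fixed hp] at this
        exact (hhigh t).trans this
      rcases Set.mem_uIcc.1 hmem with h4 | h4 <;> linarith
  · have hub : ∃ n : ℕ, z < (f ^ n) x₀ := by
      by_contra! hb
      simp only [orderIso_pow_apply] at hb
      rcases tendsto_iterate_or_fixed f.continuous f.monotone hx₀.le with h1 | ⟨p, hp, hp1, hp2⟩
      · obtain ⟨n, hn⟩ := (h1.eventually_gt_atTop z).exists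
        exact absurd (hb n) (not_le.2 hn)
      · exact hz p (Set.mem_uIcc.2 (Or.inl ⟨hp1 0, hp2 z hb⟩)) hp
    have hlb : ∃ n : ℤ, (f ^ n) x₀ ≤ z := by
      by_contra! hb
      have hb' : ∀ n : ℕ, z < (f⁻¹ ^ n) x₀ := fun n => by
        have := hb (-n)
        rwa [zpow_neg, zpow_natCast, ← inv_pow] at this
      -- The backward orbit is decreasing; it is reflected into an increasing one.
      let T : ℝ → ℝ := fun x => -f⁻¹ (-x)
      have hTn : ∀ n : ℕ, T^[n] (-x₀) = -(f⁻¹ ^ n) x₀ := by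
        intro n
        induction n with
        | zero => rfl
        | succ n ih =>
          rw [Function.iterate_succ_apply', ih, pow_succ', RelIso.mul_apply]
          simp [T]
      have hTm : Monotone T := fun x y hxy => neg_le_neg (f⁻¹.monotone (neg_le_neg hxy))
      have hTc : Continuous T := (f⁻¹.continuous.comp continuous_neg).neg
      have hTx : -x₀ ≤ T (-x₀) := by
        simp only [T, neg_neg]
        refine neg_le_neg ?_
        have := f⁻¹.monotone hx₀.le
        rwa [RelIso.inv_apply_self] at this
      rcases tendsto_iterate_or_fixed hTc hTm hTx with h1 | ⟨p, hp, hp1, hp2⟩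
      · obtain ⟨n, hn⟩ := (h1.eventually_gt_atTop (-z)).exists
        rw [hTn] at hn
        linarith [hb' n]
      · refine hz (-p) (Set.mem_uIcc.2 (Or.inr ⟨?_, ?_⟩)) ?_
        · have := hp2 (-z) fun n => by rw [hTn]; linarith [hb' n]
          linarith
        · have := hp1 0
          simp only [Function.iterate_zero, id] at this
          linarith
        · have h2 : f⁻¹ (-p) = -p := by simp only [T] at hp; linarith
          exact (inv_apply_eq_iff.1 h2).symm
    obtain ⟨N, hN⟩ := hub
    obtain ⟨n, hn, hmax⟩ := Int.exists_greatest_of_bdd (P := fun n : ℤ => (f ^ n) x₀ ≤ z)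
      ⟨N, fun m hm => by
        by_contra! hlt
        have := hzmono hlt
        simp only [zpow_natCast] at this
        linarith⟩ hlb
    have hn' : z < (f ^ (n + 1)) x₀ := by
      by_contra! hle
      have := hmax _ hle
      lia
    have h1 : x₀ ≤ (f ^ n)⁻¹ z := by
      have := (f ^ n)⁻¹.monotone hn
      rwa [RelIso.inv_apply_self] at this
    have h2 : (f ^ n)⁻¹ z < f x₀ := by
      have := (f ^ n)⁻¹.strictMono hn'
      rwa [zpow_add_one, RelIso.mul_apply, RelIso.inv_apply_self] at this
    set r := ((f ^ n)⁻¹ z - x₀) / d with hr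
    have hr0 : 0 ≤ r := div_nonneg (by linarith) hd0.le
    have hr1 : r < 1 := by rw [hr, div_lt_one hd0]; linarith
    refine ⟨n + r, ?_⟩
    have hfl : ⌊(n : ℝ) + r⌋ = n := by
      rw [Int.floor_intCast_add, Int.floor_eq_zero_iff.2 ⟨hr0, hr1⟩, add_zero]
    have hfr : Int.fract ((n : ℝ) + r) = r := by
      unfold Int.fract; rw [hfl]; ring
    simp only [h, hfl, hfr]
    rw [hr, div_mul_cancel₀ _ hd0.ne', add_sub_cancel, RelIso.apply_inv_self]

/-- A chart of the connected component of `x₀` in the complement of the fixed points of `f`, in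
which `f` becomes the translation by one.  It reverses the orientation if `f` moves `x₀` down. -/
theorem exists_chart (f : ℝ ≃o ℝ) (x₀ : ℝ) (hx₀ : f x₀ ≠ x₀) :
    ∃ h : ℝ → ℝ, (StrictMono h ∨ StrictAnti h) ∧ (∀ t, h (t + 1) = f (h t)) ∧
      (∀ t p, f p = p → p ∉ Set.uIcc x₀ (h t)) ∧
      ∀ z, (∀ p ∈ Set.uIcc x₀ z, f p ≠ p) → z ∈ Set.range h := by
  rcases hx₀.lt_or_gt with hlt | hlt
  · have hlt' : x₀ < f⁻¹ x₀ := by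
      have := f⁻¹.strictMono hlt
      rwa [RelIso.inv_apply_self] at this
    have hfix : ∀ p, f⁻¹ p = p ↔ f p = p := fun p => inv_apply_eq_iff.trans eq_comm
    obtain ⟨h, hmono, hh, hsep, hr⟩ := exists_strictMono_chart f⁻¹ x₀ hlt'
    refine ⟨fun t => h (-t), Or.inr fun s t hst => hmono (neg_lt_neg hst), fun t => ?_,
      fun t p hp => hsep _ p ((hfix p).2 hp), fun z hz => ?_⟩
    · have := hh (-(t + 1))
      rw [show -(t + 1) + 1 = -t by ring] at this
      exact inv_apply_eq_iff.1 this.symm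
    · obtain ⟨t, ht⟩ := hr z fun p hp hp' => hz p hp ((hfix p).1 hp')
      exact ⟨-t, by simpa using ht⟩
  · obtain ⟨h, hmono, hh⟩ := exists_strictMono_chart f x₀ hlt
    exact ⟨h, Or.inl hmono, hh⟩

/-- Every `f` is the image of the translation by one under an endomorphism of the group of
increasing homeomorphisms whose image fixes the fixed points of `f`: use charts on all components
of the complement of the fixed points at once. -/
theorem exists_hom_translation (f : ℝ ≃o ℝ) :
    ∃ Φ : (ℝ ≃o ℝ) →* (ℝ ≃o ℝ), Φ (OrderIso.addRight 1) = f ∧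
      ∀ a x, f x = x → Φ a x = x := by
  classical
  -- The charts are based at a chosen point `b x` of the component of `x`, so that points of the
  -- same component share their chart.
  let s : Set ℝ := {x | f x ≠ x}
  have hs : ∀ {x}, x ∈ s ↔ f x ≠ x := Iff.rfl
  let b : s → ℝ := Set.ordConnectedProj s
  have hb : ∀ x : s, Set.uIcc (b x) x ⊆ s := Set.mem_ordConnectedComponent_ordConnectedProj s
  choose H Hmono Hh Hsep Hrange using fun x : s => exists_chart f x x.2
  let h : s → ℝ → ℝ := fun x => H ⟨b x, hb x Set.left_mem_uIcc⟩
  have hinj : ∀ x, Function.Injective (h x) := fun x =>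
    (Hmono ⟨b x, hb x Set.left_mem_uIcc⟩).elim StrictMono.injective StrictAnti.injective
  have hx : ∀ x : s, ∃ t, h x t = x := fun x => Hrange _ x fun p hp => hb x hp
  have hcomp : ∀ (x : s) t, Set.uIcc (x : ℝ) (h x t) ⊆ s := fun x t => by
    have h1 : Set.uIcc (b x) (h x t) ⊆ s := fun p hp hfp =>
      Hsep ⟨b x, hb x Set.left_mem_uIcc⟩ t p hfp hp
    refine Set.uIcc_subset_uIcc_union_uIcc (b := b x) |>.trans (Set.union_subset ?_ h1)
    rw [Set.uIcc_comm]; exact hb x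
  have hcongr : ∀ x y : s, Set.uIcc (x : ℝ) y ⊆ s → h x = h y := by
    intro x y hxy
    have : b x = b y := Set.ordConnectedProj_eq.2 hxy
    simp only [h, this]
  have hmem : ∀ (x : s) t, h x t ∈ s := fun x t => hcomp x t Set.right_mem_uIcc
  let F : (ℝ ≃o ℝ) → ℝ → ℝ := fun a x =>
    if hx : x ∈ s then h ⟨x, hx⟩ (a (Function.invFun (h ⟨x, hx⟩) x)) else x
  have hF : ∀ a x t, F a (h x t) = h x (a t) := by
    intro a x t
    have h1 : h ⟨h x t, hmem x t⟩ = h x := (hcongr x ⟨h x t, hmem x t⟩ (hcomp x t)).symm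
    simp only [F]
    rw [dif_pos (hmem x t), h1, Function.leftInverse_invFun (hinj x) t]
  have hFn : ∀ a, ∀ x ∉ s, F a x = x := fun a x hx => dif_neg hx
  have hFcomp : ∀ a (x : s), Set.uIcc (x : ℝ) (F a x) ⊆ s := by
    intro a x
    obtain ⟨t, ht⟩ := hx x
    have h1 := hF a x t
    rw [ht] at h1
    rw [h1]; exact hcomp x _
  refine ⟨homOfMonotoneAction F ?_ ?_ ?_, ?_, fun a x hx => hFn a x (not_not.2 hx)⟩
  · intro x
    by_cases hxs : x ∈ s
    · obtain ⟨t, ht⟩ := hx ⟨x, hxs⟩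
      simp only at ht
      rw [← ht]
      exact hF 1 ⟨x, hxs⟩ t
    · exact hFn _ x hxs
  · intro g k x
    by_cases hxs : x ∈ s
    · obtain ⟨t, ht⟩ := hx ⟨x, hxs⟩
      simp only at ht
      rw [← ht, hF, hF, hF, RelIso.mul_apply]
    · rw [hFn _ x hxs, hFn _ x hxs, hFn _ x hxs]
  · intro a x y hxy
    by_cases hcase : Set.uIcc x y ⊆ s
    · have hxs : x ∈ s := hcase Set.left_mem_uIcc
      have hys : y ∈ s := hcase Set.right_mem_uIcc
      obtain ⟨t, ht⟩ := hx ⟨x, hxs⟩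
      obtain ⟨r, hr⟩ := hx ⟨y, hys⟩
      rw [← hcongr ⟨x, hxs⟩ ⟨y, hys⟩ hcase] at hr
      simp only at ht hr
      rw [← ht, ← hr] at hxy ⊢
      rw [hF, hF]
      rcases Hmono ⟨b ⟨x, hxs⟩, hb ⟨x, hxs⟩ Set.left_mem_uIcc⟩ with hm | hm
      · exact hm.monotone (a.monotone (hm.le_iff_le.1 hxy))
      · exact hm.antitone (a.monotone (hm.le_iff_ge.1 hxy))
    -- Points of different components are separated by a fixed point of `f`.
    · obtain ⟨p, hp, hps⟩ := Set.not_subset.1 hcase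
      rw [Set.uIcc_of_le hxy] at hp
      have h1 : F a x ≤ p := by
        by_cases hxs : x ∈ s
        · by_contra! hlt
          exact hps (hFcomp a ⟨x, hxs⟩ (Set.mem_uIcc.2 (Or.inl ⟨hp.1, hlt.le⟩)))
        · rw [hFn a x hxs]; exact hp.1
      have h2 : p ≤ F a y := by
        by_cases hys : y ∈ s
        · by_contra! hlt
          exact hps (hFcomp a ⟨y, hys⟩ (Set.mem_uIcc.2 (Or.inr ⟨hlt.le, hp.2⟩)))
        · rw [hFn a y hys]; exact hp.2
      exact h1.trans h2
  · ext x
    change F (OrderIso.addRight 1) x = f x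
    by_cases hxs : x ∈ s
    · obtain ⟨t, ht⟩ := hx ⟨x, hxs⟩
      simp only at ht
      rw [← ht, hF]
      exact Hh _ t
    · rw [hFn _ x hxs]; exact (not_not.1 hxs).symm

/-! ### Solving `w = f` in the group of homeomorphisms -/

/-- The generators of a free group can act on the line so that a given non-empty cyclically reduced
word acts without fixed points: its letters move the integers step by step along a bi-infinite
chain. -/
theorem exists_chain_int {ι : Type*} (L : List (ι × Bool)) (hL : L ≠ [])
    (hred : FreeGroup.IsCyclicallyReduced L) :
    ∃ a : ι → ℝ ≃o ℝ, ∀ q : ℤ, (FreeGroup.lift a (FreeGroup.mk L))⁻¹ (L.length * q : ℝ) =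
      L.length * (q + 1 : ℝ) := by
  have hk : 0 < L.length := List.length_pos_iff.2 hL
  have hk' : (0 : ℤ) < L.length := by exact_mod_cast hk
  let l : ℤ → ι × Bool := fun j => periodicWord L hL (j % L.length).toNat
  have hlper : ∀ (j q : ℤ), l (j + L.length * q) = l j := fun j q => by
    simp only [l, Int.add_mul_emod_self_left]
  have hlnat : ∀ (q : ℤ) (i : ℕ), l (L.length * q + i) = periodicWord L hL i := fun q i => by
    rw [add_comm, hlper]
    simp only [l, periodicWord]
    congr 1
    have : ((i : ℤ) % L.length).toNat = i % L.length := by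
      rw [← Int.natCast_mod, Int.toNat_natCast]
    rw [this, Nat.mod_mod]
  have hlred : ∀ j, (l j).1 = (l (j + 1)).1 → (l j).2 = (l (j + 1)).2 := by
    intro j
    obtain ⟨i, hi⟩ := Int.eq_ofNat_of_zero_le (Int.emod_nonneg j hk'.ne')
    have hj : j = L.length * (j / L.length) + i := by rw [← hi, Int.mul_ediv_add_emod]
    have h1 := hlnat (j / L.length) i
    have h2 := hlnat (j / L.length) (i + 1)
    push_cast at h2
    rw [← add_assoc, ← hj] at h2
    rw [← hj] at h1
    rw [h1, h2]
    exact periodicWord_reduced hL hred i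
  -- The point that the `j`-th step of the chain puts on the graph of the generator of `l j`.
  let c : ℤ → ℝ × ℝ := fun j => if (l j).2 then ((j : ℝ) + 1, (j : ℝ)) else ((j : ℝ), (j : ℝ) + 1)
  have hc : ∀ j k, j < k → (l j).1 = (l k).1 → (c j).1 < (c k).1 ∧ (c j).2 < (c k).2 := by
    intro j k hjk hl
    have hlt : (l j).2 ≠ (l k).2 → (j : ℝ) + 1 < k := by
      intro h
      have : j + 1 < k := by
        refine lt_of_le_of_ne hjk ?_
        rintro rfl
        exact h (hlred j hl)
      exact_mod_cast this
    have h2 : (j : ℝ) < k := by exact_mod_cast hjk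
    have h3 : (j : ℝ) < k + 1 := by linarith
    rcases hj : (l j).2 <;> rcases hk : (l k).2 <;> simp only [hj, hk] at hlt <;>
      simp [c, hj, hk, h2, h3, hlt]
  have hc1 : ∀ j, ∃ i : ℤ, (c j).1 = i := fun j => by
    rcases h : (l j).2
    · exact ⟨j, by simp [c, h]⟩
    · exact ⟨j + 1, by simp [c, h]⟩
  have hc2 : ∀ j, ∃ i : ℤ, (c j).2 = i := fun j => by
    rcases h : (l j).2
    · exact ⟨j + 1, by simp [c, h]⟩
    · exact ⟨j, by simp [c, h]⟩
  have hclosed : ∀ s : Set ℝ, (∀ x ∈ s, ∃ i : ℤ, x = i) → IsClosed s := by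
    intro s hs
    have : s = (fun i : ℤ => (i : ℝ)) '' {i : ℤ | (i : ℝ) ∈ s} := by
      ext x
      constructor
      · intro hx
        obtain ⟨i, rfl⟩ := hs x hx
        exact ⟨i, hx, rfl⟩
      · rintro ⟨i, hi, rfl⟩; exact hi
    rw [this]
    exact Int.isClosedEmbedding_coe_real.isClosedMap _ (isClosed_discrete _)
  have key : ∀ i, ∃ e : ℝ ≃o ℝ, ∀ j, (l j).1 = i → e (c j).1 = (c j).2 := by
    intro i
    -- A generator which does not occur in the word is not constrained.
    by_cases hi : ∃ j₀, (l j₀).1 = i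
    swap
    · exact ⟨1, fun j hj => absurd ⟨j, hj⟩ hi⟩
    obtain ⟨j₀, hj₀⟩ := hi
    have hhigh : ∀ b : ℝ, ∃ j, (l j).1 = i ∧ b ≤ j := fun b => by
      refine ⟨j₀ + L.length * (|⌈b⌉| + |j₀|), by rw [hlper]; exact hj₀, ?_⟩
      have h1 : ⌈b⌉ ≤ j₀ + L.length * (|⌈b⌉| + |j₀|) := by
        have h2 := le_abs_self ⌈b⌉
        have h3 := neg_abs_le j₀
        have h4 : 0 ≤ |⌈b⌉| + |j₀| := by positivity
        nlinarith
      exact (Int.le_ceil b).trans (by exact_mod_cast h1)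
    have hlow : ∀ b : ℝ, ∃ j, (l j).1 = i ∧ (j : ℝ) + 1 ≤ b := fun b => by
      refine ⟨j₀ + L.length * -(|⌊b⌋| + |j₀| + 1), by rw [hlper]; exact hj₀, ?_⟩
      have h1 : j₀ + L.length * -(|⌊b⌋| + |j₀| + 1) + 1 ≤ ⌊b⌋ := by
        have h2 := neg_abs_le ⌊b⌋
        have h3 := le_abs_self j₀
        have h4 : 0 ≤ |⌊b⌋| + |j₀| := by positivity
        nlinarith
      exact le_trans (by exact_mod_cast h1) (Int.floor_le b)
    have hcle : ∀ j : ℤ, (j : ℝ) ≤ (c j).1 ∧ (j : ℝ) ≤ (c j).2 ∧ (c j).1 ≤ (j : ℝ) + 1 ∧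
        (c j).2 ≤ (j : ℝ) + 1 := fun j => by
      rcases h : (l j).2 <;> simp [c, h]
    suffices h : ∃ e : ℝ ≃o ℝ, ∀ p ∈ c '' {j | (l j).1 = i}, e p.1 = p.2 from
      h.imp fun e he j hj => he _ ⟨j, hj, rfl⟩
    refine exists_orderIso_of_monotone_relation _ ?_ (hclosed _ ?_) (hclosed _ ?_) ?_ ?_ ?_ ?_
    · rintro _ ⟨j, hj, rfl⟩ _ ⟨k, hk, rfl⟩
      rcases lt_trichotomy j k with h | rfl | h
      · have := hc j k h (hj.trans hk.symm)
        exact iff_of_true this.1 this.2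
      · simp
      · have := hc k j h (hk.trans hj.symm)
        exact iff_of_false this.1.not_gt this.2.not_gt
    · rintro _ ⟨_, ⟨j, -, rfl⟩, rfl⟩
      obtain ⟨i, hi⟩ := hc1 j
      exact ⟨i, hi⟩
    · rintro _ ⟨_, ⟨j, -, rfl⟩, rfl⟩
      obtain ⟨i, hi⟩ := hc2 j
      exact ⟨i, hi⟩
    · intro b
      obtain ⟨j, hj, hb⟩ := hhigh b
      exact ⟨_, ⟨j, hj, rfl⟩, hb.trans (hcle j).1⟩
    · intro b
      obtain ⟨j, hj, hb⟩ := hlow b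
      exact ⟨_, ⟨j, hj, rfl⟩, (hcle j).2.2.1.trans hb⟩
    · intro b
      obtain ⟨j, hj, hb⟩ := hhigh b
      exact ⟨_, ⟨j, hj, rfl⟩, hb.trans (hcle j).2.1⟩
    · intro b
      obtain ⟨j, hj, hb⟩ := hlow b
      exact ⟨_, ⟨j, hj, rfl⟩, (hcle j).2.2.2.trans hb⟩
  choose a ha using key
  have hchain : ∀ j : ℤ, letterMap a (l j) ((j : ℝ) + 1) = j := by
    intro j
    have h := ha (l j).1 j rfl
    unfold letterMap
    rcases hb : (l j).2
    · simp only [c, hb] at h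
      simp only [Bool.false_eq_true, if_false] at h
      rw [cond_false, ← h, RelIso.inv_apply_self]
    · simp only [c, hb, if_true] at h
      rw [cond_true, h]
  refine ⟨a, fun q => ?_⟩
  have h1 := lift_mk_chain a (fun i => (L.length * q : ℝ) + i) L 0 fun i hi => by
    have h2 := hchain (L.length * q + i)
    rw [hlnat] at h2
    have h3 : periodicWord L hL i = L[i] := by
      simp [periodicWord, Nat.mod_eq_of_lt hi]
    rw [h3] at h2
    push_cast at h2 ⊢
    rw [zero_add, ← add_assoc]
    exact h2
  simp only [zero_add, Nat.cast_zero, add_zero] at h1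
  rw [inv_apply_eq_iff, mul_add, mul_one, h1]

/-- Every `f` is the value of a given non-empty cyclically reduced word for some action of the
generators on the line which fixes the fixed points of `f`. -/
theorem exists_hom_mk_eq {ι : Type*} (L : List (ι × Bool)) (hL : L ≠ [])
    (hred : FreeGroup.IsCyclicallyReduced L) (f : ℝ ≃o ℝ) :
    ∃ τ : FreeGroup ι →* (ℝ ≃o ℝ), τ (FreeGroup.mk L) = f ∧ ∀ g x, f x = x → τ g x = x := by
  have hk : (0 : ℝ) < L.length := by exact_mod_cast List.length_pos_iff.2 hL
  obtain ⟨a, ha⟩ := exists_chain_int L hL hred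
  set W := (FreeGroup.lift a (FreeGroup.mk L))⁻¹ with hW
  have hWx : ∀ x, x < W x := by
    intro x
    have h1 : (L.length : ℝ) * ⌊x / L.length⌋ ≤ x := by
      have := Int.floor_le (x / L.length)
      rwa [le_div_iff₀' hk] at this
    have h2 : x < (L.length : ℝ) * (⌊x / L.length⌋ + 1) := by
      have := Int.lt_floor_add_one (x / L.length)
      rwa [div_lt_iff₀' hk] at this
    refine h2.trans_le ?_
    rw [← ha]
    exact W.monotone h1
  -- `W` is conjugate to the translation by one, which `Φ` sends to `f⁻¹`.
  obtain ⟨h, hmono, hh, -, hr⟩ := exists_strictMono_chart W 0 (hWx 0)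
  have hsurj : Function.Surjective h := fun z => hr z fun p _ => (hWx p).ne'
  let e : ℝ ≃o ℝ := hmono.orderIsoOfSurjective h hsurj
  have he : ∀ x, e (x + 1) = W (e x) := hh
  obtain ⟨Φ, hΦ, hfix⟩ := exists_hom_translation f⁻¹
  refine ⟨Φ.comp ((MulAut.conj e⁻¹).toMonoidHom.comp (FreeGroup.lift a)), ?_, fun g x hx => ?_⟩
  · have h1 : (MulAut.conj e⁻¹) W = OrderIso.addRight 1 := by
      ext x
      simp only [MulAut.conj_apply, inv_inv, RelIso.mul_apply]
      rw [← he, RelIso.inv_apply_self]; rfl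
    have h2 : FreeGroup.lift a (FreeGroup.mk L) = W⁻¹ := (inv_inv _).symm
    simp only [MonoidHom.comp_apply, h2, _root_.map_inv]
    change (Φ ((MulAut.conj e⁻¹) W))⁻¹ = f
    rw [h1, hΦ, inv_inv]
  · exact hfix _ x (inv_apply_eq_iff.2 hx.symm)

/-- An action `F` of the free group on a lower set `D`, for which a word acts as `f`, extends to
an action on the line for which it still acts as `f`.  The points of the complement of `D` have
to be bounded below by fixed points of `f` in this complement. -/
theorem exists_hom_mk_eq_of_fixed {ι : Type*} (L : List (ι × Bool)) (hL : L ≠ [])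
    (hred : FreeGroup.IsCyclicallyReduced L) (f : ℝ ≃o ℝ) (D : Set ℝ) (hD : IsLowerSet D)
    (hfD : ∀ x ∉ D, ∃ q ∉ D, f q = q ∧ q ≤ x)
    (F : FreeGroup ι → ℝ → ℝ) (hF1 : ∀ x ∈ D, F 1 x = x) (hFD : ∀ g, ∀ x ∈ D, F g x ∈ D)
    (hFmul : ∀ g k, ∀ x ∈ D, F (g * k) x = F g (F k x)) (hFmono : ∀ g, MonotoneOn (F g) D)
    (hFf : ∀ x ∈ D, F (FreeGroup.mk L) x = f x) :
    ∃ σ : FreeGroup ι →* (ℝ ≃o ℝ), σ (FreeGroup.mk L) = f ∧ ∀ g, ∀ x ∈ D, σ g x = F g x := by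
  obtain ⟨τ, hτ, hfix⟩ := exists_hom_mk_eq L hL hred f
  have hτD : ∀ g, ∀ x ∉ D, τ g x ∉ D := by
    intro g x hx hx'
    obtain ⟨q, hq, hfq, hqx⟩ := hfD x hx
    have := (τ g).monotone hqx
    rw [hfix g q hfq] at this
    exact hq (hD this hx')
  obtain ⟨σ, hσ₁, hσ₂⟩ := exists_glued_hom D hD F (fun g x => τ g x) hF1 hFD hFmul hFmono
    (fun x _ => by simp) hτD (fun g k x _ => by simp) (fun g => (τ g).monotone.monotoneOn _)
  refine ⟨σ, ?_, hσ₁⟩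
  ext x
  by_cases hx : x ∈ D
  · rw [hσ₁ _ x hx, hFf x hx]
  · rw [hσ₂ _ x hx, hτ]

/-! ### Extending the second factor -/

open Filter in
/-- If the inverse of a word moves `y` upwards, then any homeomorphism `f` which agrees with it on
`(-∞, y]` can be realised as the inverse of this word by an action agreeing with the given
one inside `(-∞, y]²`.  First the orbit of `y` is made to escape to `+∞`; the resulting action is
conjugated, fixing `(-∞, y]`, onto the union `D` of the half-lines `(-∞, f ^ N y]`, and beyond `D`
the equation is solved freely. -/
theorem exists_hom_inv_eq {ι : Type*} (L : List (ι × Bool)) (hL : L ≠ [])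
    (hred : FreeGroup.IsCyclicallyReduced L) (a : ι → ℝ ≃o ℝ) (y : ℝ)
    (hy : y < (FreeGroup.lift a (FreeGroup.mk L))⁻¹ y) (f : ℝ ≃o ℝ)
    (hf : ∀ x ≤ y, f x = (FreeGroup.lift a (FreeGroup.mk L))⁻¹ x) :
    ∃ σ : FreeGroup ι →* (ℝ ≃o ℝ), AgreeBelow y a (fun i => σ (FreeGroup.of i)) ∧
      (σ (FreeGroup.mk L))⁻¹ = f := by
  obtain ⟨M, hyM, a', ha', hagree, hesc⟩ := exists_escape_of_lt a L hL hred y hy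
  set W := (FreeGroup.lift a' (FreeGroup.mk L))⁻¹ with hW
  have hfW : ∀ x ≤ y, f x = W x := fun x hx => by rw [hf x hx, hagree x hx]
  have hyW : y < W y := by rw [hagree y le_rfl]; exact hy
  have hWinv : ∀ z ≤ y, W⁻¹ z ≤ y := fun z hz => by
    have := W⁻¹.monotone (hz.trans hyW.le)
    rwa [RelIso.inv_apply_self] at this
  have hdown : ∀ N : ℕ, ∀ z ≤ y, (W ^ N)⁻¹ z ≤ y := by
    intro N
    induction N with
    | zero => intro z hz; simpa using hz
    | succ N ih =>
      intro z hz
      rw [pow_succ', mul_inv_rev, RelIso.mul_apply]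
      exact ih _ (hWinv z hz)
  have hex : ∀ x, ∃ N : ℕ, (W ^ N)⁻¹ x ≤ y := fun x => by
    obtain ⟨N, hN⟩ := (hesc.eventually_ge_atTop x).exists
    refine ⟨N, ?_⟩
    have := (W ^ N)⁻¹.monotone hN
    rwa [RelIso.inv_apply_self] at this
  have hstable : ∀ x (N k : ℕ), (W ^ N)⁻¹ x ≤ y →
      (W ^ (N + k))⁻¹ x ≤ y ∧ (f ^ (N + k)) ((W ^ (N + k))⁻¹ x) = (f ^ N) ((W ^ N)⁻¹ x) := by
    intro x N k hN
    induction k with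
    | zero => exact ⟨hN, rfl⟩
    | succ k ih =>
      have h1 : (W ^ (N + (k + 1)))⁻¹ x = W⁻¹ ((W ^ (N + k))⁻¹ x) := by
        rw [← add_assoc, pow_succ, mul_inv_rev, RelIso.mul_apply]
      have h2 := hWinv _ ih.1
      refine ⟨h1 ▸ h2, ?_⟩
      rw [h1, ← add_assoc, pow_succ, RelIso.mul_apply, hfW _ h2, RelIso.apply_inv_self, ih.2]
  -- The conjugating map is `f ^ n ∘ W ^ (-n)`, which does not depend on the large number `n`.
  choose N hN using hex
  let ψ : ℝ → ℝ := fun x => (f ^ N x) ((W ^ N x)⁻¹ x)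
  have hψ : ∀ x n, (W ^ n)⁻¹ x ≤ y → ψ x = (f ^ n) ((W ^ n)⁻¹ x) := by
    intro x n hn
    rcases le_total n (N x) with h | h
    · obtain ⟨k, hk⟩ := Nat.exists_eq_add_of_le h
      simp only [ψ, hk]
      exact (hstable x n k hn).2
    · obtain ⟨k, rfl⟩ := Nat.exists_eq_add_of_le h
      exact (hstable x (N x) k (hN x)).2.symm
  have hψmono : StrictMono ψ := by
    intro x z hxz
    have hx := (W ^ N z)⁻¹.monotone hxz.le
    rw [hψ x (N z) (hx.trans (hN z))]
    exact (f ^ N z).strictMono ((W ^ N z)⁻¹.strictMono hxz)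
  have hψid : ∀ x ≤ y, ψ x = x := fun x hx => by
    rw [hψ x 0 (by simpa using hx)]; simp
  have hψW : ∀ x, ψ (W x) = f (ψ x) := by
    intro x
    have h1 : (W ^ (N x + 1))⁻¹ (W x) = (W ^ N x)⁻¹ x := by
      rw [pow_succ', mul_inv_rev, RelIso.mul_apply, RelIso.inv_apply_self]
    rw [hψ (W x) (N x + 1) (h1 ▸ hN x), h1, pow_succ', RelIso.mul_apply]
  have hrange : ∀ z, z ∈ Set.range ψ ↔ ∃ n : ℕ, (f ^ n)⁻¹ z ≤ y := by
    intro z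
    constructor
    · rintro ⟨x, rfl⟩
      exact ⟨N x, by rw [RelIso.inv_apply_self]; exact hN x⟩
    · rintro ⟨n, hn⟩
      refine ⟨(W ^ n) ((f ^ n)⁻¹ z), ?_⟩
      rw [hψ _ n (by rwa [RelIso.inv_apply_self]), RelIso.inv_apply_self, RelIso.apply_inv_self]
  have hD : IsLowerSet (Set.range ψ) := by
    intro x z hzx hx
    obtain ⟨n, hn⟩ := (hrange x).1 hx
    exact (hrange z).2 ⟨n, ((f ^ n)⁻¹.monotone hzx).trans hn⟩
  have hyf : y < f y := by rw [hfW y le_rfl]; exact hyW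
  -- If `D` is not the whole line, its supremum is a fixed point of `f`.
  have hfD : ∀ x ∉ Set.range ψ, ∃ q ∉ Set.range ψ, f⁻¹ q = q ∧ q ≤ x := by
    intro x hx
    have hlt : ∀ n, f^[n] y ≤ x := by
      intro n
      by_contra! h
      refine hx ((hrange x).2 ⟨n, ?_⟩)
      have := (f ^ n)⁻¹.monotone h.le
      rwa [← orderIso_pow_apply, RelIso.inv_apply_self] at this
    rcases tendsto_iterate_or_fixed f.continuous f.monotone hyf.le with h | ⟨p, hp, hp1, hp2⟩
    · obtain ⟨n, hn⟩ := (h.eventually_gt_atTop x).exists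
      exact absurd (hlt n) (not_le.2 hn)
    · refine ⟨p, fun hmem => ?_, inv_apply_eq_iff.2 hp.symm, hp2 x hlt⟩
      obtain ⟨n, hn⟩ := (hrange p).1 hmem
      have h1 : (f ^ n)⁻¹ p = p := by
        rw [inv_apply_eq_iff]
        have := zpow_fixed hp n
        rw [zpow_natCast] at this
        exact this.symm
      rw [h1] at hn
      exact absurd (hyf.trans_le (hp1 1)) (not_lt.2 hn)
  have hinv : ∀ t, Function.invFun ψ (ψ t) = t := Function.leftInverse_invFun hψmono.injective
  obtain ⟨σ, hσf, hσ⟩ := exists_hom_mk_eq_of_fixed L hL hred f⁻¹ (Set.range ψ) hD hfD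
    (fun g x => ψ (FreeGroup.lift a' g (Function.invFun ψ x)))
    (by rintro _ ⟨t, rfl⟩; simp [hinv])
    (fun g x _ => ⟨_, rfl⟩)
    (by rintro g k _ ⟨t, rfl⟩; simp [hinv])
    (by
      rintro g _ ⟨t, rfl⟩ _ ⟨s, rfl⟩ hts
      simp only [hinv]
      exact hψmono.monotone ((FreeGroup.lift a' g).monotone (hψmono.le_iff_le.1 hts)))
    (by
      rintro _ ⟨t, rfl⟩
      simp only [hinv]
      refine (inv_apply_eq_iff.2 ?_).symm
      rw [← hψW, hW, RelIso.inv_apply_self])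
  refine ⟨σ, fun i x hx hax => ?_, by rw [hσf, inv_inv]⟩
  have h1 : x ∈ Set.range ψ := ⟨x, hψid x hx⟩
  have h2 := hσ (FreeGroup.of i) x h1
  have h3 : Function.invFun ψ x = x := by
    nth_rewrite 1 [← hψid x hx]; exact hinv x
  rw [h2, h3, FreeGroup.lift_apply_of, ha' i x (hx.trans hyM) (hax.trans hyM), hψid _ hax]

/-! ### Deforming pairs of actions -/

/-- The homeomorphisms attached by an action of a free group to the free generators. -/
def gens {ι : Type*} (σ : FreeGroup ι →* (ℝ ≃o ℝ)) : ι → ℝ ≃o ℝ := fun i => σ (FreeGroup.of i)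

theorem lift_gens {ι : Type*} (σ : FreeGroup ι →* (ℝ ≃o ℝ)) : FreeGroup.lift (gens σ) = σ :=
  MonoidHom.ext fun _ => (FreeGroup.lift_unique σ fun _ => rfl).symm

theorem gens_lift {ι : Type*} (a : ι → ℝ ≃o ℝ) : gens (FreeGroup.lift a) = a :=
  funext fun _ => FreeGroup.lift_apply_of

theorem gens_fixed_iff {ι : Type*} {σ : FreeGroup ι →* (ℝ ≃o ℝ)} {x : ℝ} :
    (∀ i, gens σ i x = x) ↔ ∀ g, σ g x = x :=
  ⟨fun h g => by rw [← lift_gens σ]; exact lift_fixed h g, fun h _ => h _⟩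

/-- The pair of actions can be changed outside of `(-∞, K]²` to a pair of actions which satisfies
the relation `w₁ = w₂`, has no common fixed point and is not mapped to the given pair by a
monotone equivariant map that tends to `+∞` at `+∞`. -/
def Deformable {ι κ : Type*} (w₁ : FreeGroup ι) (w₂ : FreeGroup κ)
    (σ₁ : FreeGroup ι →* (ℝ ≃o ℝ)) (σ₂ : FreeGroup κ →* (ℝ ≃o ℝ)) (K : ℝ) : Prop :=
  ∃ (τ₁ : FreeGroup ι →* (ℝ ≃o ℝ)) (τ₂ : FreeGroup κ →* (ℝ ≃o ℝ)),
    AgreeBelow K (gens σ₁) (gens τ₁) ∧ AgreeBelow K (gens σ₂) (gens τ₂) ∧ τ₁ w₁ = τ₂ w₂ ∧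
    (∀ x, ¬ ((∀ i, gens τ₁ i x = x) ∧ ∀ i, gens τ₂ i x = x)) ∧
    ¬ ∃ c : ℝ → ℝ, Monotone c ∧ Filter.Tendsto c Filter.atTop Filter.atTop ∧
      (∀ g x, c (τ₁ g x) = σ₁ g (c x)) ∧ ∀ g x, c (τ₂ g x) = σ₂ g (c x)

theorem Deformable.swap {ι κ : Type*} {w₁ : FreeGroup ι} {w₂ : FreeGroup κ}
    {σ₁ : FreeGroup ι →* (ℝ ≃o ℝ)} {σ₂ : FreeGroup κ →* (ℝ ≃o ℝ)} {K : ℝ}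
    (h : Deformable w₁ w₂ σ₁ σ₂ K) : Deformable w₂ w₁ σ₂ σ₁ K := by
  obtain ⟨τ₁, τ₂, h1, h2, h3, h4, h5⟩ := h
  exact ⟨τ₂, τ₁, h2, h1, h3.symm, fun x hx => h4 x hx.symm,
    fun ⟨c, hc, hc', hc1, hc2⟩ => h5 ⟨c, hc, hc', hc2, hc1⟩⟩

theorem Deformable.of_inv {ι κ : Type*} {w₁ : FreeGroup ι} {w₂ : FreeGroup κ}
    {σ₁ : FreeGroup ι →* (ℝ ≃o ℝ)} {σ₂ : FreeGroup κ →* (ℝ ≃o ℝ)} {K : ℝ}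
    (h : Deformable w₁⁻¹ w₂⁻¹ σ₁ σ₂ K) : Deformable w₁ w₂ σ₁ σ₂ K := by
  obtain ⟨τ₁, τ₂, h1, h2, h3, h4⟩ := h
  exact ⟨τ₁, τ₂, h1, h2, inv_injective (by simpa using h3), h4⟩

theorem isCyclicallyReduced_invRev {ι : Type*} {L : List (ι × Bool)}
    (h : FreeGroup.IsCyclicallyReduced L) :
    FreeGroup.IsCyclicallyReduced (FreeGroup.invRev L) := by
  classical
  refine ⟨?_, ?_⟩
  · rw [FreeGroup.isReduced_iff_reduce_eq, FreeGroup.reduce_invRev, h.1.reduce_eq]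
  · intro a ha b hb hab
    simp only [FreeGroup.invRev, List.getLast?_reverse, List.head?_reverse, List.head?_map,
      List.getLast?_map, Option.mem_def, Option.map_eq_some_iff] at ha hb
    obtain ⟨a', ha', rfl⟩ := ha
    obtain ⟨b', hb', rfl⟩ := hb
    have := h.2 b' hb' a' ha' hab.symm
    simp [this]

theorem invRev_ne_nil {ι : Type*} {L : List (ι × Bool)} (h : L ≠ []) :
    FreeGroup.invRev L ≠ [] := by
  simpa [FreeGroup.invRev] using h

open Filter in
/-- Escaping orbits are preserved by equivariant maps. -/
theorem escape_of_semiconj {f g : ℝ ≃o ℝ} {c : ℝ → ℝ} (hc : Tendsto c atTop atTop)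
    (hcfg : ∀ x, c (f x) = g (c x)) (h : ∃ z, Tendsto (fun t : ℕ => (f ^ t) z) atTop atTop) :
    ∃ z, Tendsto (fun t : ℕ => (g ^ t) z) atTop atTop := by
  obtain ⟨z, hz⟩ := h
  refine ⟨c z, (hc.comp hz).congr fun t => ?_⟩
  simp only [Function.comp_apply, orderIso_pow_apply]
  exact (Function.Semiconj.iterate_right hcfg t) z

open Filter in
theorem not_escape_of_fixed {g : ℝ ≃o ℝ} (hg : ∀ R, ∃ p, R ≤ p ∧ g p = p) :
    ¬ ∃ z, Tendsto (fun t : ℕ => (g ^ t) z) atTop atTop := by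
  rintro ⟨z, hz⟩
  obtain ⟨p, hzp, hp⟩ := hg z
  obtain ⟨t, ht⟩ := (hz.eventually_gt_atTop p).exists
  have h1 := (g ^ t).monotone hzp
  have h2 := zpow_fixed hp t
  rw [zpow_natCast] at h2
  rw [h2] at h1
  exact absurd ht (not_lt.2 h1)

open Filter in
theorem not_escape_both (g : ℝ ≃o ℝ)
    (h1 : ∃ z, Tendsto (fun t : ℕ => (g ^ t) z) atTop atTop)
    (h2 : ∃ z, Tendsto (fun t : ℕ => (g⁻¹ ^ t) z) atTop atTop) : False := by
  obtain ⟨z, hz⟩ := h1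
  obtain ⟨y, hy⟩ := h2
  obtain ⟨t, ht1, ht2⟩ := ((hz.eventually_gt_atTop y).and (hy.eventually_gt_atTop z)).exists
  have := (g ^ t).strictMono ht2
  rw [inv_pow, RelIso.apply_inv_self] at this
  exact absurd ht1 (not_lt.2 this.le)

open Filter in
/-- If the inverse of the common word moves `y` upwards, the pair of actions can be changed
outside of `(-∞, y]²` so that some orbit of the inverse of a given cyclically reduced word `L` of
the first factor escapes to `+∞`.  Taking for `L` the common word or its inverse prescribes the
direction of the common word near `+∞`. -/
theorem exists_pair_escape {ι κ : Type*} [Nontrivial ι] {L₁ : List (ι × Bool)} (hL₁ : L₁ ≠ [])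
    {L₂ : List (κ × Bool)} (hL₂ : L₂ ≠ [])
    (hred₂ : FreeGroup.IsCyclicallyReduced L₂)
    {σ₁ : FreeGroup ι →* (ℝ ≃o ℝ)} {σ₂ : FreeGroup κ →* (ℝ ≃o ℝ)}
    (hσ : σ₁ (FreeGroup.mk L₁) = σ₂ (FreeGroup.mk L₂))
    (hfix : ∀ x, ¬ ((∀ i, gens σ₁ i x = x) ∧ ∀ i, gens σ₂ i x = x)) {y : ℝ}
    (hy : y < (σ₁ (FreeGroup.mk L₁))⁻¹ y) (L : List (ι × Bool)) (hL : L ≠ [])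
    (hred : FreeGroup.IsCyclicallyReduced L) :
    ∃ (τ₁ : FreeGroup ι →* (ℝ ≃o ℝ)) (τ₂ : FreeGroup κ →* (ℝ ≃o ℝ)),
      AgreeBelow y (gens σ₁) (gens τ₁) ∧ AgreeBelow y (gens σ₂) (gens τ₂) ∧
      τ₁ (FreeGroup.mk L₁) = τ₂ (FreeGroup.mk L₂) ∧
      (∀ x, ¬ ((∀ i, gens τ₁ i x = x) ∧ ∀ i, gens τ₂ i x = x)) ∧
      ∃ z, Tendsto (fun t : ℕ => ((τ₁ (FreeGroup.mk L))⁻¹ ^ t) z) atTop atTop := by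
  obtain ⟨M, hyM, -, -, hagree, hheight⟩ := exists_height (gens σ₁) L₁ hL₁ y
  have hM : ∃ i, gens σ₁ i M ≠ M := by
    by_contra! h
    rcases hyM.lt_or_eq with h1 | rfl
    · exact lt_irrefl _ (hheight M h1 h)
    · have h2 := inv_apply_eq_iff.2 (gens_fixed_iff.1 h (FreeGroup.mk L₁)).symm
      exact hy.ne' h2
  obtain ⟨a, ha, hafix, hesc⟩ := exists_fixedPointFree_escape (gens σ₁) M hM L hL hred
  have hτ₁ : ∀ x ≤ y, (FreeGroup.lift a (FreeGroup.mk L₁))⁻¹ x =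
      (FreeGroup.lift (gens σ₂) (FreeGroup.mk L₂))⁻¹ x := fun x hx => by
    rw [hagree a ha x hx, lift_gens, lift_gens, hσ]
  obtain ⟨τ₂, hτ₂, hτ⟩ := exists_hom_inv_eq L₂ hL₂ hred₂ (gens σ₂) y
    (by rw [lift_gens, ← hσ]; exact hy) _ hτ₁
  refine ⟨FreeGroup.lift a, τ₂, ?_, hτ₂, (inv_injective hτ).symm, fun x hx => ?_, hesc⟩
  · rw [gens_lift]; exact ha.mono hyM
  · rw [gens_lift] at hx
    rcases lt_or_ge M x with h | h
    · obtain ⟨i, hi⟩ := hafix x h.le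
      exact hi (hx.1 i)
    · have h1 := ha.fixed h hx.1
      rcases lt_or_ge y x with h' | h'
      · exact absurd (hheight x h' h1) (not_lt.2 h)
      · exact hfix x ⟨h1, hτ₂.fixed h' hx.2⟩

/-- If the inverse of the common word moves a point of `[K, ∞)` upwards, its direction near `+∞` can
be prescribed.  The given pair cannot be compatible with both directions. -/
theorem deformable_of_lt {ι κ : Type*} [Nontrivial ι] {L₁ : List (ι × Bool)} (hL₁ : L₁ ≠ [])
    (hred₁ : FreeGroup.IsCyclicallyReduced L₁) {L₂ : List (κ × Bool)} (hL₂ : L₂ ≠ [])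
    (hred₂ : FreeGroup.IsCyclicallyReduced L₂)
    {σ₁ : FreeGroup ι →* (ℝ ≃o ℝ)} {σ₂ : FreeGroup κ →* (ℝ ≃o ℝ)}
    (hσ : σ₁ (FreeGroup.mk L₁) = σ₂ (FreeGroup.mk L₂))
    (hfix : ∀ x, ¬ ((∀ i, gens σ₁ i x = x) ∧ ∀ i, gens σ₂ i x = x)) {K y : ℝ} (hKy : K ≤ y)
    (hy : y < (σ₁ (FreeGroup.mk L₁))⁻¹ y) :
    Deformable (FreeGroup.mk L₁) (FreeGroup.mk L₂) σ₁ σ₂ K := by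
  by_contra hdef
  obtain ⟨τ₁, τ₂, h1, h2, h3, h4, h5⟩ :=
    exists_pair_escape hL₁ hL₂ hred₂ hσ hfix hy L₁ hL₁ hred₁
  obtain ⟨υ₁, υ₂, k1, k2, k3, k4, k5⟩ :=
    exists_pair_escape hL₁ hL₂ hred₂ hσ hfix hy _ (invRev_ne_nil hL₁)
      (isCyclicallyReduced_invRev hred₁)
  refine hdef ⟨τ₁, τ₂, h1.mono hKy, h2.mono hKy, h3, h4, ?_⟩
  rintro ⟨c, -, hc, hcτ, -⟩
  refine hdef ⟨υ₁, υ₂, k1.mono hKy, k2.mono hKy, k3, k4, ?_⟩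
  rintro ⟨d, -, hd, hdυ, -⟩
  -- Otherwise both the word and its inverse would have escaping orbits in the given action.
  refine not_escape_both (σ₁ (FreeGroup.mk L₁)) ?_ ?_
  · refine escape_of_semiconj hd (hdυ _) ?_
    simpa only [← FreeGroup.inv_mk, _root_.map_inv, inv_inv] using k5
  · rw [← _root_.map_inv] at h5 ⊢
    exact escape_of_semiconj hc (hcτ _) h5

theorem deformable_of_ne {ι κ : Type*} [Nontrivial ι] {L₁ : List (ι × Bool)} (hL₁ : L₁ ≠ [])
    (hred₁ : FreeGroup.IsCyclicallyReduced L₁) {L₂ : List (κ × Bool)} (hL₂ : L₂ ≠ [])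
    (hred₂ : FreeGroup.IsCyclicallyReduced L₂)
    {σ₁ : FreeGroup ι →* (ℝ ≃o ℝ)} {σ₂ : FreeGroup κ →* (ℝ ≃o ℝ)}
    (hσ : σ₁ (FreeGroup.mk L₁) = σ₂ (FreeGroup.mk L₂))
    (hfix : ∀ x, ¬ ((∀ i, gens σ₁ i x = x) ∧ ∀ i, gens σ₂ i x = x)) {K y : ℝ} (hKy : K ≤ y)
    (hy : σ₁ (FreeGroup.mk L₁) y ≠ y) :
    Deformable (FreeGroup.mk L₁) (FreeGroup.mk L₂) σ₁ σ₂ K := by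
  rcases hy.lt_or_gt with h | h
  · refine deformable_of_lt hL₁ hred₁ hL₂ hred₂ hσ hfix hKy ?_
    have := (σ₁ (FreeGroup.mk L₁))⁻¹.strictMono h
    rwa [RelIso.inv_apply_self] at this
  · refine Deformable.of_inv ?_
    rw [FreeGroup.inv_mk, FreeGroup.inv_mk]
    refine deformable_of_lt (invRev_ne_nil hL₁) (isCyclicallyReduced_invRev hred₁)
      (invRev_ne_nil hL₂) (isCyclicallyReduced_invRev hred₂) ?_ hfix hKy ?_
    · simp only [← FreeGroup.inv_mk, _root_.map_inv, hσ]
    · simpa only [← FreeGroup.inv_mk, _root_.map_inv, inv_inv] using h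

/-- The homeomorphism which fixes `(-∞, a]` and doubles the distance to `a` on `[a, ∞)`. -/
theorem exists_pushRight (a : ℝ) : ∃ T : ℝ ≃o ℝ, ∀ x, T x = x + max 0 (x - a) := by
  have hmono : StrictMono fun x : ℝ => x + max 0 (x - a) := fun x y hxy =>
    add_lt_add_of_lt_of_le hxy (max_le_max le_rfl (by linarith))
  have hsurj : Function.Surjective fun x : ℝ => x + max 0 (x - a) := by
    intro z
    rcases le_total z a with h | h
    · exact ⟨z, by simp [h]⟩
    · refine ⟨(z + a) / 2, ?_⟩
      simp only
      rw [max_eq_right (by linarith)]; ring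
  exact ⟨hmono.orderIsoOfSurjective _ hsurj, fun x => rfl⟩

open Filter in
/-- If the common word acts trivially near `+∞` and the first action has fixed points arbitrarily
far to the right, then this action can be replaced near `+∞` by an action through
a homomorphism to `ℤ` killing the word, which has no fixed points there. -/
theorem deformable_of_fixed {ι κ : Type*} {w₁ : FreeGroup ι} {w₂ : FreeGroup κ}
    {σ₁ : FreeGroup ι →* (ℝ ≃o ℝ)} {σ₂ : FreeGroup κ →* (ℝ ≃o ℝ)} (hσ : σ₁ w₁ = σ₂ w₂)
    (hfix : ∀ x, ¬ ((∀ i, gens σ₁ i x = x) ∧ ∀ i, gens σ₂ i x = x)) (K : ℝ) {R : ℝ}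
    (hR : ∀ x, R ≤ x → σ₁ w₁ x = x) (hcof : ∀ b, ∃ x, b ≤ x ∧ ∀ i, gens σ₁ i x = x)
    (χ : FreeGroup ι →* Multiplicative ℤ) (hχ : χ w₁ = 1) (i₀ : ι)
    (hi₀ : χ (FreeGroup.of i₀) ≠ 1) : Deformable w₁ w₂ σ₁ σ₂ K := by
  obtain ⟨a, hRa, ha⟩ := hcof (max K R)
  have haσ : ∀ g, σ₁ g a = a := gens_fixed_iff.1 ha
  obtain ⟨T, hT⟩ := exists_pushRight a
  have hTa : T a = a := by simp [hT]
  have hTx : ∀ x, a < x → x < T x := fun x hx => by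
    rw [hT, max_eq_right (by linarith)]; linarith
  let θ : FreeGroup ι →* (ℝ ≃o ℝ) := (zpowersHom (ℝ ≃o ℝ) T).comp χ
  have hθ : ∀ g, θ g = T ^ (Multiplicative.toAdd (χ g)) := fun g => rfl
  have hθa : ∀ g, θ g a = a := fun g => by rw [hθ, zpow_fixed hTa]
  obtain ⟨τ₁, hτ, hτ'⟩ := exists_glued_hom (Set.Iio a) (isLowerSet_Iio a) (fun g x => σ₁ g x)
    (fun g x => θ g x) (fun x _ => by simp)
    (fun g x hx => by
      have := (σ₁ g).strictMono (Set.mem_Iio.1 hx)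
      rwa [haσ] at this)
    (fun g k x _ => by simp) (fun g => (σ₁ g).monotone.monotoneOn _) (fun x _ => by simp)
    (fun g x hx => by
      rw [Set.mem_Iio, not_lt] at hx ⊢
      have := (θ g).monotone hx
      rwa [hθa] at this)
    (fun g k x _ => by simp) (fun g => (θ g).monotone.monotoneOn _)
  have hτa : ∀ x, x ≤ a → ∀ g, τ₁ g x = σ₁ g x := by
    intro x hx g
    rcases hx.lt_or_eq with h | rfl
    · exact hτ g x h
    · rw [hτ' g x (by simp), hθa, haσ]
  -- Some element, a generator or its inverse, moves all points of `(a, ∞)` upwards.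
  obtain ⟨g, hg⟩ : ∃ g, ∀ x, a < x → x < θ g x := by
    let m := Multiplicative.toAdd (χ (FreeGroup.of i₀))
    have hm : m ≠ 0 := fun h => hi₀ (by simpa [m] using h)
    have hg : ∃ k : ℕ, 0 < k ∧ θ (FreeGroup.of i₀ ^ m.sign) = T ^ k := by
      refine ⟨m.natAbs, Int.natAbs_pos.2 hm, ?_⟩
      rw [hθ, map_zpow, toAdd_zpow, smul_eq_mul]
      change T ^ (m.sign * m) = T ^ m.natAbs
      rw [Int.sign_mul_self_eq_abs, ← zpow_natCast, Int.natCast_natAbs]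
    obtain ⟨k, hk, hgk⟩ := hg
    refine ⟨FreeGroup.of i₀ ^ m.sign, fun x hx => ?_⟩
    have : ∀ k : ℕ, x < (T ^ (k + 1)) x := by
      intro k
      induction k with
      | zero => simpa using hTx x hx
      | succ k ih => rw [pow_succ', RelIso.mul_apply]; exact ih.trans (hTx _ (hx.trans ih))
    rw [hgk]
    obtain ⟨k, rfl⟩ := Nat.exists_eq_add_of_lt hk
    simpa using this k
  have hesc : ∃ z, Tendsto (fun t : ℕ => (τ₁ g ^ t) z) atTop atTop := by
    refine ⟨a + 1, ?_⟩
    have hpow : ∀ t : ℕ, (τ₁ g ^ t) (a + 1) = (θ g)^[t] (a + 1) := fun t => by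
      rw [← map_pow, hτ' _ _ (by simp), map_pow, orderIso_pow_apply]
    simp only [hpow]
    rcases tendsto_iterate_or_fixed (θ g).continuous (θ g).monotone
      (hg (a + 1) (by linarith)).le with h | ⟨p, hp, hp1, -⟩
    · exact h
    · have := hp1 0
      simp only [Function.iterate_zero, id] at this
      exact absurd hp (hg p (by linarith)).ne'
  have hKa : K ≤ a := (le_max_left _ _).trans hRa
  refine ⟨τ₁, σ₂, fun i x hx _ => hτa x (hx.trans hKa) _, fun i x _ _ => rfl, ?_, fun x hx => ?_,
    ?_⟩
  · rw [← hσ]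
    ext x
    rcases le_total x a with h | h
    · exact hτa x h _
    · rw [hτ' _ x (by simpa using h), hθ, hχ, toAdd_one, zpow_zero, RelIso.one_apply,
        hR x ((le_max_right _ _).trans (hRa.trans h))]
  · rcases le_or_gt x a with h | h
    · exact hfix x ⟨fun i => (hτa x h _).symm.trans (hx.1 i), hx.2⟩
    · have h1 := gens_fixed_iff.1 hx.1 g
      rw [hτ' g x (by simpa using h.le)] at h1
      exact (hg x h).ne' h1
  · rintro ⟨c, -, hc, hcτ, -⟩
    refine not_escape_of_fixed (fun b => ?_) (escape_of_semiconj hc (hcτ g) hesc)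
    obtain ⟨x, hbx, hx⟩ := hcof b
    exact ⟨x, hbx, gens_fixed_iff.1 hx g⟩

open Filter in
/-- If the common word acts trivially near `+∞`, where the first action has no fixed points but
the second one does, then the second action can be cut at a fixed point `b`; this makes room
for changing the first one, and with it the value of the word, far to the right. -/
theorem deformable_of_fixed_right {ι κ : Type*} [Nontrivial ι] {L₁ : List (ι × Bool)}
    (hL₁ : L₁ ≠ []) (hred₁ : FreeGroup.IsCyclicallyReduced L₁) {L₂ : List (κ × Bool)}
    (hL₂ : L₂ ≠ []) (hred₂ : FreeGroup.IsCyclicallyReduced L₂)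
    {σ₁ : FreeGroup ι →* (ℝ ≃o ℝ)} {σ₂ : FreeGroup κ →* (ℝ ≃o ℝ)}
    (hσ : σ₁ (FreeGroup.mk L₁) = σ₂ (FreeGroup.mk L₂))
    (hfix : ∀ x, ¬ ((∀ i, gens σ₁ i x = x) ∧ ∀ i, gens σ₂ i x = x)) (K : ℝ) {R : ℝ}
    (hR : ∀ x, R ≤ x → σ₁ (FreeGroup.mk L₁) x = x) (h₁ : ∀ x, R ≤ x → ∃ i, gens σ₁ i x ≠ x)
    (h₂ : ∀ b, ∃ x, b ≤ x ∧ ∀ i, gens σ₂ i x = x) :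
    Deformable (FreeGroup.mk L₁) (FreeGroup.mk L₂) σ₁ σ₂ K := by
  obtain ⟨b, hb, hbfix⟩ := h₂ (max K R + 1)
  have hKb : K < b := by linarith [le_max_left K R]
  have hRb : R < b := by linarith [le_max_right K R]
  have hσb : ∀ g, σ₂ g b = b := gens_fixed_iff.1 hbfix
  obtain ⟨M, hbM, -, -, hagree, -⟩ := exists_height (gens σ₁) L₁ hL₁ b
  obtain ⟨a, ha, hafix, hesc⟩ :=
    exists_fixedPointFree_escape (gens σ₁) M (h₁ M (hRb.le.trans hbM)) L₁ hL₁ hred₁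
  set f := FreeGroup.lift a (FreeGroup.mk L₁) with hf
  have hσf : ∀ x ≤ b, f x = σ₂ (FreeGroup.mk L₂) x := by
    intro x hx
    have h1 : σ₂ (FreeGroup.mk L₂) x ≤ b := by
      have := (σ₂ (FreeGroup.mk L₂)).monotone hx
      rwa [hσb] at this
    have h2 := hagree a ha _ h1
    rw [lift_gens, hσ, RelIso.inv_apply_self, inv_apply_eq_iff] at h2
    exact h2.symm
  have hfb : f b = b := by rw [hσf b le_rfl, hσb]
  obtain ⟨τ₂, hτ₂, hτ⟩ := exists_hom_mk_eq_of_fixed L₂ hL₂ hred₂ f (Set.Iio b) (isLowerSet_Iio b)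
    (fun x hx => ⟨b, by simp, hfb, by simpa using hx⟩) (fun g x => σ₂ g x) (fun x _ => by simp)
    (fun g x hx => by
      have := (σ₂ g).strictMono (Set.mem_Iio.1 hx)
      rwa [hσb] at this)
    (fun g k x _ => by simp) (fun g => (σ₂ g).monotone.monotoneOn _)
    (fun x hx => (hσf x (le_of_lt hx)).symm)
  refine ⟨FreeGroup.lift a, τ₂, ?_, fun i x hx _ => hτ _ x (lt_of_le_of_lt hx hKb), hτ₂.symm,
    fun x hx => ?_, ?_⟩
  · rw [gens_lift]; exact ha.mono (hKb.le.trans hbM)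
  · rw [gens_lift] at hx
    rcases lt_or_ge M x with h | h
    · obtain ⟨i, hi⟩ := hafix x h.le
      exact hi (hx.1 i)
    · have hx1 := ha.fixed h hx.1
      rcases lt_or_ge x b with h' | h'
      · exact hfix x ⟨hx1, fun i => (hτ _ x h').symm.trans (hx.2 i)⟩
      · obtain ⟨i, hi⟩ := h₁ x (hRb.le.trans h')
        exact hi (hx1 i)
  · rintro ⟨c, -, hc, hcτ, -⟩
    have h3 := escape_of_semiconj (g := (σ₁ (FreeGroup.mk L₁))⁻¹) hc
      (by simpa only [_root_.map_inv] using hcτ (FreeGroup.mk L₁)⁻¹) hesc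
    exact not_escape_of_fixed (fun p => ⟨max p R, le_max_left _ _,
      inv_apply_eq_iff.2 (hR _ (le_max_right _ _)).symm⟩) h3

/-! ### Bending -/

/-- The upper envelope of the generators of an action and their inverses: every monotone map
commuting with the action commutes with it. -/
theorem exists_envelope {ι : Type*} [Finite ι] [Nonempty ι] (σ : FreeGroup ι →* (ℝ ≃o ℝ)) :
    ∃ T : ℝ → ℝ, Continuous T ∧ Monotone T ∧ (∀ x, x ≤ T x) ∧
      (∀ x, (∃ i, gens σ i x ≠ x) → x < T x) ∧
      ∀ c : ℝ → ℝ, Monotone c → (∀ g x, c (σ g x) = σ g (c x)) → ∀ x, c (T x) = T (c x) := by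
  cases nonempty_fintype ι
  have hne : (Finset.univ : Finset (ι × Bool)).Nonempty := Finset.univ_nonempty
  have hle : ∀ l x, letterMap (gens σ) l x ≤
      Finset.univ.sup' hne fun l => letterMap (gens σ) l x := fun l x =>
    Finset.le_sup' (fun l => letterMap (gens σ) l x) (Finset.mem_univ l)
  have hmove : ∀ i x, gens σ i x ≠ x →
      x < Finset.univ.sup' hne fun l => letterMap (gens σ) l x := by
    intro i x hx
    rcases hx.lt_or_gt with h | h
    · refine lt_of_lt_of_le ?_ (hle (i, false) x)
      have := (gens σ i)⁻¹.strictMono h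
      rwa [RelIso.inv_apply_self] at this
    · exact lt_of_lt_of_le h (hle (i, true) x)
  refine ⟨fun x => Finset.univ.sup' hne fun l => letterMap (gens σ) l x, ?_, ?_, ?_, ?_, ?_⟩
  · exact Continuous.finset_sup'_apply hne fun l _ => (letterMap (gens σ) l).continuous
  · intro x y hxy
    exact Finset.sup'_le _ _ fun l _ => ((letterMap (gens σ) l).monotone hxy).trans (hle l y)
  · intro x
    obtain ⟨i⟩ := ‹Nonempty ι›
    by_cases h : gens σ i x = x
    · exact h.symm.le.trans (hle (i, true) x)
    · exact (hmove i x h).le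
  · rintro x ⟨i, hi⟩
    exact hmove i x hi
  · intro c hc hcσ x
    have hl : ∀ l y, c (letterMap (gens σ) l y) = letterMap (gens σ) l (c y) := by
      rintro ⟨i, _ | _⟩ y
      · have := hcσ (FreeGroup.of i)⁻¹ y
        rwa [_root_.map_inv] at this
      · exact hcσ (FreeGroup.of i) y
    simp only [← hl]
    refine le_antisymm ?_ (Finset.sup'_le _ _ fun l _ => hc (hle l x))
    obtain ⟨l, -, h⟩ := Finset.exists_mem_eq_sup' hne fun l => letterMap (gens σ) l x
    rw [h]
    exact Finset.le_sup' (fun l => c (letterMap (gens σ) l x)) (Finset.mem_univ l)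

open Filter in
/-- A monotone map commuting with a map `T` without fixed points near `+∞` stays within a bounded
number of steps of `T` from the identity. -/
theorem exists_iterate_bounds {T c : ℝ → ℝ} (hT : Continuous T) (hTm : Monotone T)
    (hTle : ∀ x, x ≤ T x) {R : ℝ} (hTR : ∀ x, R ≤ x → x < T x) (hc : Monotone c)
    (hctop : Tendsto c atTop atTop) (hcT : ∀ x, c (T x) = T (c x)) :
    ∃ (N : ℕ) (X : ℝ), ∀ x, X ≤ x → x ≤ T^[N] (c x) ∧ c x ≤ T^[N] x := by
  have htop : ∀ x, R ≤ x → Tendsto (fun n => T^[n] x) atTop atTop := by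
    intro x hx
    rcases tendsto_iterate_or_fixed hT hTm (hTle x) with h | ⟨p, hp, hp1, -⟩
    · exact h
    · exact absurd hp (hTR p (hx.trans (hp1 0))).ne'
  have hcn : ∀ n x, c (T^[n] x) = T^[n] (c x) := fun n x =>
    (Function.Semiconj.iterate_right hcT n) x
  have hle : ∀ x {m n : ℕ}, m ≤ n → T^[m] x ≤ T^[n] x := fun x m n hmn =>
    hTm.monotone_iterate_of_le_map (hTle x) hmn
  obtain ⟨x₀, hx₀R, hx₀c⟩ := ((eventually_ge_atTop R).and (hctop.eventually_ge_atTop R)).exists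
  obtain ⟨N₁, hN₁⟩ := ((htop _ hx₀c).eventually_ge_atTop (T x₀)).exists
  obtain ⟨N₂, hN₂⟩ := ((htop _ hx₀R).eventually_ge_atTop (c (T x₀))).exists
  refine ⟨max N₁ N₂, x₀, fun x hx => ?_⟩
  have hex : ∃ n, x < T^[n] x₀ := ((htop _ hx₀R).eventually_gt_atTop x).exists
  classical
  obtain ⟨n, hn⟩ : ∃ n, Nat.find hex = n + 1 := by
    refine Nat.exists_eq_succ_of_ne_zero fun h0 => ?_
    have := Nat.find_spec hex
    rw [h0] at this
    exact absurd hx (not_le.2 this)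
  have h1 : x < T^[n] (T x₀) := by
    have := Nat.find_spec hex
    rwa [hn, Function.iterate_succ_apply] at this
  have h2 : T^[n] x₀ ≤ x := not_lt.1 (Nat.find_min hex (by lia))
  constructor
  · calc x ≤ T^[n] (T x₀) := h1.le
      _ ≤ T^[n] (T^[N₁] (c x₀)) := hTm.iterate n hN₁
      _ = T^[N₁] (T^[n] (c x₀)) := (Function.Commute.iterate_iterate_self T n N₁) _
      _ = T^[N₁] (c (T^[n] x₀)) := by rw [hcn]
      _ ≤ T^[N₁] (c x) := hTm.iterate _ (hc h2)
      _ ≤ T^[max N₁ N₂] (c x) := hle _ (le_max_left _ _)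
  · calc c x ≤ c (T^[n] (T x₀)) := hc h1.le
      _ = T^[n] (c (T x₀)) := hcn _ _
      _ ≤ T^[n] (T^[N₂] x₀) := hTm.iterate n hN₂
      _ = T^[N₂] (T^[n] x₀) := (Function.Commute.iterate_iterate_self T n N₂) _
      _ ≤ T^[N₂] x := hTm.iterate _ h2
      _ ≤ T^[max N₁ N₂] x := hle _ (le_max_right _ _)

/-- Homeomorphisms supported near `+∞` can grow arbitrarily fast. -/
theorem exists_orderIso_fast (K : ℝ) (H : ℕ → ℝ) :
    ∃ φ : ℝ ≃o ℝ, (∀ x ≤ K, φ x = x) ∧ ∀ j : ℕ, H j ≤ φ (K + 1 + j) := by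
  let G : ℕ → ℝ := fun j => K + 1 + j + ∑ i ∈ Finset.range (j + 1), (|H i| + |K|)
  have hsum : ∀ j : ℕ, 0 ≤ ∑ i ∈ Finset.range (j + 1), (|H i| + |K|) := fun j => by positivity
  have hGmono : StrictMono G := by
    refine strictMono_nat_of_lt_succ fun j => ?_
    have h1 : 0 ≤ |H (j + 1)| + |K| := by positivity
    simp only [G]
    rw [Finset.sum_range_succ _ (j + 1)]
    push_cast; linarith
  have hGK : ∀ j : ℕ, K + 1 + j ≤ G j := fun j => by
    have := hsum j
    simp only [G]; linarith
  have hGH : ∀ j : ℕ, H j ≤ G j := fun j => by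
    have h1 : |H j| + |K| ≤ ∑ i ∈ Finset.range (j + 1), (|H i| + |K|) :=
      Finset.single_le_sum (f := fun i => |H i| + |K|) (fun i _ => by positivity)
        (Finset.self_mem_range_succ j)
    have h2 := le_abs_self (H j)
    have h3 := neg_abs_le K
    have h4 : (0 : ℝ) ≤ j := Nat.cast_nonneg j
    simp only [G]; linarith
  let S₀ : Set (ℝ × ℝ) := (fun x => (x, x)) '' Set.Iic K
  let S₁ : Set (ℝ × ℝ) := (fun j : ℕ => (K + 1 + (j : ℝ), G j)) '' Set.univ
  have h01 : ∀ p ∈ S₀, ∀ q ∈ S₁, p.1 < q.1 ∧ p.2 < q.2 := by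
    rintro _ ⟨x, hx, rfl⟩ _ ⟨j, -, rfl⟩
    have h1 := hGK j
    have h2 : (0 : ℝ) ≤ j := Nat.cast_nonneg j
    simp only [Set.mem_Iic] at hx ⊢
    constructor <;> linarith
  have hhigh : ∀ b : ℝ, ∃ p ∈ S₁, b ≤ p.1 := fun b => by
    obtain ⟨j, hj⟩ := exists_nat_ge (b - (K + 1))
    exact ⟨_, ⟨j, trivial, rfl⟩, by simp only; linarith⟩
  have hhigh' : ∀ p ∈ S₁, p.1 ≤ p.2 := by
    rintro _ ⟨j, -, rfl⟩
    exact hGK j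
  suffices h : ∃ e : ℝ ≃o ℝ, ∀ p ∈ S₀ ∪ S₁, e p.1 = p.2 by
    obtain ⟨e, he⟩ := h
    refine ⟨e, fun x hx => he (x, x) (Or.inl ⟨x, hx, rfl⟩), fun j => ?_⟩
    rw [he (K + 1 + (j : ℝ), G j) (Or.inr ⟨j, trivial, rfl⟩)]
    exact hGH j
  refine exists_orderIso_of_monotone_relation (S₀ ∪ S₁) ?_ ?_ ?_ ?_ ?_ ?_ ?_
  · rintro p (hp | hp) q (hq | hq)
    · obtain ⟨x, -, rfl⟩ := hp
      obtain ⟨y, -, rfl⟩ := hq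
      exact Iff.rfl
    · have := h01 p hp q hq
      exact iff_of_true this.1 this.2
    · have := h01 q hq p hp
      exact iff_of_false this.1.not_gt this.2.not_gt
    · obtain ⟨i, -, rfl⟩ := hp
      obtain ⟨j, -, rfl⟩ := hq
      simp [hGmono.lt_iff_lt]
  · rw [Set.image_union, Set.image_image, Set.image_image]
    refine IsClosed.union ?_ (isClosed_range_of_le fun j => le_rfl)
    simpa using isClosed_Iic
  · rw [Set.image_union, Set.image_image, Set.image_image]
    refine IsClosed.union ?_ (isClosed_range_of_le hGK)
    simpa using isClosed_Iic
  · intro b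
    obtain ⟨p, hp, hb⟩ := hhigh b
    exact ⟨p, Or.inr hp, hb⟩
  · exact fun b => ⟨_, Or.inl ⟨min b K, by simp, rfl⟩, by simp⟩
  · intro b
    obtain ⟨p, hp, hb⟩ := hhigh b
    exact ⟨p, Or.inr hp, hb.trans (hhigh' p hp)⟩
  · exact fun b => ⟨_, Or.inl ⟨min b K, by simp, rfl⟩, by simp⟩

open Filter in
/-- If the common word acts trivially near `+∞`, where neither action has fixed points, the second
action can be conjugated by a homeomorphism `φ` supported near `+∞`.  A monotone map `c` from
the new pair to the old one commutes with the first action and `c ∘ φ` commutes with the second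
one, which bounds the growth of `φ`. -/
theorem deformable_of_bending {ι κ : Type*} [Finite ι] [Nonempty ι] [Finite κ] [Nonempty κ]
    {w₁ : FreeGroup ι} {w₂ : FreeGroup κ}
    {σ₁ : FreeGroup ι →* (ℝ ≃o ℝ)} {σ₂ : FreeGroup κ →* (ℝ ≃o ℝ)} (hσ : σ₁ w₁ = σ₂ w₂)
    (hfix : ∀ x, ¬ ((∀ i, gens σ₁ i x = x) ∧ ∀ i, gens σ₂ i x = x)) (K : ℝ) {R : ℝ}
    (hR : ∀ x, R ≤ x → σ₁ w₁ x = x) (h₁ : ∀ x, R ≤ x → ∃ i, gens σ₁ i x ≠ x)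
    (h₂ : ∀ x, R ≤ x → ∃ i, gens σ₂ i x ≠ x) : Deformable w₁ w₂ σ₁ σ₂ K := by
  obtain ⟨T₁, hT₁c, hT₁m, hT₁le, hT₁lt, hT₁⟩ := exists_envelope σ₁
  obtain ⟨T₂, hT₂c, hT₂m, hT₂le, hT₂lt, hT₂⟩ := exists_envelope σ₂
  set Q := max K R with hQ
  obtain ⟨φ, hφ, hφfast⟩ := exists_orderIso_fast Q
    fun j => T₁^[j] (T₂^[j] (Q + 1 + j)) + 1
  have hφinv : ∀ x ≤ Q, φ⁻¹ x = x := fun x hx => inv_apply_eq_iff.2 (hφ x hx).symm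
  have hRQ : R ≤ Q := le_max_right _ _
  let τ₂ : FreeGroup κ →* (ℝ ≃o ℝ) := (MulAut.conj φ).toMonoidHom.comp σ₂
  have hτ₂ : ∀ g x, τ₂ g x = φ (σ₂ g (φ⁻¹ x)) := fun g x => rfl
  refine ⟨σ₁, τ₂, fun i x _ _ => rfl, fun i x hx hax => ?_, ?_, fun x hx => ?_, ?_⟩
  · have hKQ : K ≤ Q := le_max_left _ _
    change τ₂ _ x = _
    rw [hτ₂, hφinv x (hx.trans hKQ)]
    exact hφ _ (hax.trans hKQ)
  · ext x
    rw [hτ₂, ← hσ]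
    rcases le_total x R with h | h
    · rw [hφinv x (h.trans hRQ), hφ]
      have := (σ₁ w₁).monotone h
      rw [hR R le_rfl] at this
      exact this.trans hRQ
    · have h1 : R ≤ φ⁻¹ x := by
        have := φ⁻¹.monotone h
        rwa [hφinv R hRQ] at this
      rw [hR _ h1, hR x h, RelIso.apply_inv_self]
  · have hxR : x < R := by
      by_contra! h
      obtain ⟨i, hi⟩ := h₁ x h
      exact hi (hx.1 i)
    refine hfix x ⟨hx.1, fun i => ?_⟩
    have h1 : τ₂ (FreeGroup.of i) x = x := hx.2 i
    rw [hτ₂, hφinv x (hxR.le.trans hRQ)] at h1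
    have h2 := inv_apply_eq_iff.2 h1.symm
    rw [hφinv x (hxR.le.trans hRQ)] at h2
    exact h2.symm
  · rintro ⟨c, hc, hctop, hc1, hc2⟩
    have hφtop : Tendsto φ atTop atTop := φ.tendsto_atTop
    -- On the sequence `Q + 1 + j`, the bounds for `c` and `c ∘ φ` contradict the growth of `φ`.
    have hd2 : ∀ g x, (c ∘ φ) (σ₂ g x) = σ₂ g ((c ∘ φ) x) := by
      intro g x
      have := hc2 g (φ x)
      rwa [hτ₂, RelIso.inv_apply_self] at this
    obtain ⟨N₁, X₁, hN₁⟩ := exists_iterate_bounds hT₁c hT₁m hT₁le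
      (fun x hx => hT₁lt x (h₁ x hx)) hc hctop (hT₁ c hc hc1)
    obtain ⟨N₂, X₂, hN₂⟩ := exists_iterate_bounds hT₂c hT₂m hT₂le
      (fun x hx => hT₂lt x (h₂ x hx)) (hc.comp φ.monotone) (hctop.comp hφtop)
      (hT₂ (c ∘ φ) (hc.comp φ.monotone) hd2)
    have hseq : Tendsto (fun j : ℕ => Q + 1 + (j : ℝ)) atTop atTop :=
      tendsto_atTop_add_const_left _ _ tendsto_natCast_atTop_atTop
    obtain ⟨j, hj1, hj2, hj3, hj4⟩ := (((hφtop.comp hseq).eventually_ge_atTop X₁).and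
      ((hseq.eventually_ge_atTop X₂).and
        ((eventually_ge_atTop N₁).and (eventually_ge_atTop N₂)))).exists
    have h1 := (hN₁ _ hj1).1
    have h2 := (hN₂ _ hj2).2
    have h3 := hφfast j
    simp only [Function.comp_apply] at h1 h2
    have h4 : T₁^[N₁] (c (φ (Q + 1 + j))) ≤ T₁^[j] (T₂^[j] (Q + 1 + j)) :=
      calc T₁^[N₁] (c (φ (Q + 1 + j))) ≤ T₁^[N₁] (T₂^[N₂] (Q + 1 + j)) := hT₁m.iterate _ h2
        _ ≤ T₁^[N₁] (T₂^[j] (Q + 1 + j)) :=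
          hT₁m.iterate _ (hT₂m.monotone_iterate_of_le_map (hT₂le _) hj4)
        _ ≤ T₁^[j] (T₂^[j] (Q + 1 + j)) := hT₁m.monotone_iterate_of_le_map (hT₁le _) hj3
    linarith

/-! ### Every pair of actions can be deformed -/

/-- A free group of rank at least two has a non-trivial homomorphism to `ℤ` killing a given
element. -/
theorem exists_hom_int_killing {ι : Type*} [Nontrivial ι] (w : FreeGroup ι) :
    ∃ χ : FreeGroup ι →* Multiplicative ℤ, χ w = 1 ∧ ∃ i, χ (FreeGroup.of i) ≠ 1 := by
  classical
  obtain ⟨i, j, hij⟩ := exists_pair_ne ι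
  let e : ι → FreeGroup ι →* Multiplicative ℤ := fun i =>
    FreeGroup.lift fun k => Multiplicative.ofAdd (if k = i then 1 else 0)
  -- Two exponent sums of `w` always satisfy a non-trivial linear relation.
  by_cases h : e i w = 1
  · exact ⟨e i, h, i, by simp [e]⟩
  · refine ⟨e i ^ Multiplicative.toAdd (e j w) * (e j ^ Multiplicative.toAdd (e i w))⁻¹, ?_, j, ?_⟩
    · simp only [MonoidHom.mul_apply, MonoidHom.inv_apply]
      apply Multiplicative.toAdd.injective
      have hz : ∀ (ψ : FreeGroup ι →* Multiplicative ℤ) (n : ℤ), (ψ ^ n) w = (ψ w) ^ n :=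
        fun ψ n => rfl
      rw [hz, hz, toAdd_mul, toAdd_inv, toAdd_zpow, toAdd_zpow, toAdd_one]
      simp only [smul_eq_mul]
      ring
    · intro h1
      refine h (Multiplicative.toAdd.injective ?_)
      have hz : ∀ (ψ : FreeGroup ι →* Multiplicative ℤ) (n : ℤ),
          (ψ ^ n) (FreeGroup.of j) = (ψ (FreeGroup.of j)) ^ n := fun ψ n => rfl
      have h2 := congrArg Multiplicative.toAdd h1
      simp only [MonoidHom.mul_apply, MonoidHom.inv_apply] at h2
      rw [hz, hz, toAdd_mul, toAdd_inv, toAdd_zpow, toAdd_zpow, toAdd_one] at h2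
      simpa [e, hij.symm] using h2

/-- Every pair of actions without common fixed points which satisfies the relation `w₁ = w₂`
can be deformed, if the two words are cyclically reduced. -/
theorem deformable_of_isCyclicallyReduced {ι κ : Type*} [Finite ι] [Nontrivial ι] [Finite κ]
    [Nonempty κ] {L₁ : List (ι × Bool)} {L₂ : List (κ × Bool)} (hL : L₁ = [] ↔ L₂ = [])
    (hred₁ : FreeGroup.IsCyclicallyReduced L₁) (hred₂ : FreeGroup.IsCyclicallyReduced L₂)
    {σ₁ : FreeGroup ι →* (ℝ ≃o ℝ)} {σ₂ : FreeGroup κ →* (ℝ ≃o ℝ)}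
    (hσ : σ₁ (FreeGroup.mk L₁) = σ₂ (FreeGroup.mk L₂))
    (hfix : ∀ x, ¬ ((∀ i, gens σ₁ i x = x) ∧ ∀ i, gens σ₂ i x = x)) (K : ℝ) :
    Deformable (FreeGroup.mk L₁) (FreeGroup.mk L₂) σ₁ σ₂ K := by
  by_cases hmove : ∃ y, K ≤ y ∧ σ₁ (FreeGroup.mk L₁) y ≠ y
  · obtain ⟨y, hKy, hy⟩ := hmove
    have hL₁ : L₁ ≠ [] := by
      rintro rfl
      exact hy (by rw [← FreeGroup.one_eq_mk]; simp)
    exact deformable_of_ne hL₁ hred₁ (fun h => hL₁ (hL.2 h)) hred₂ hσ hfix hKy hy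
  push Not at hmove
  by_cases h₁ : ∀ b, ∃ x, b ≤ x ∧ ∀ i, gens σ₁ i x = x
  · obtain ⟨χ, hχ, i, hi⟩ := exists_hom_int_killing (FreeGroup.mk L₁)
    exact deformable_of_fixed hσ hfix K hmove h₁ χ hχ i hi
  push Not at h₁
  obtain ⟨R₁, hR₁⟩ := h₁
  by_cases h₂ : ∀ b, ∃ x, b ≤ x ∧ ∀ i, gens σ₂ i x = x
  · by_cases hL₁ : L₁ = []
    · have hw : FreeGroup.mk L₂ = 1 := by rw [hL.1 hL₁, FreeGroup.one_eq_mk]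
      -- Both words are trivial, so that the roles of the two factors can be exchanged; any
      -- homomorphism to `ℤ` kills `w₂`.
      obtain ⟨i⟩ := ‹Nonempty κ›
      have h : Deformable (FreeGroup.mk L₂) (FreeGroup.mk L₁) σ₂ σ₁ K :=
        deformable_of_fixed (R := K) hσ.symm (fun x hx => hfix x hx.symm) K
          (fun x hx => by rw [← hσ]; exact hmove x hx) h₂
          (FreeGroup.lift fun _ => Multiplicative.ofAdd 1) (by rw [hw, map_one]) i
          (by rw [FreeGroup.lift_apply_of]; decide)
      exact h.swap
    · exact deformable_of_fixed_right hL₁ hred₁ (fun h => hL₁ (hL.2 h)) hred₂ hσ hfix K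
        (R := max K R₁) (fun x hx => hmove x ((le_max_left _ _).trans hx))
        (fun x hx => hR₁ x ((le_max_right _ _).trans hx)) h₂
  · push Not at h₂
    obtain ⟨R₂, hR₂⟩ := h₂
    exact deformable_of_bending hσ hfix K (R := max K (max R₁ R₂))
      (fun x hx => hmove x ((le_max_left _ _).trans hx))
      (fun x hx => hR₁ x (((le_max_left _ _).trans (le_max_right _ _)).trans hx))
      (fun x hx => hR₂ x (((le_max_right _ _).trans (le_max_right _ _)).trans hx))

/-! ### Representations of the amalgamated product -/

/-- Increasing homeomorphisms of the line are the same thing as order automorphisms. -/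
def homeoPlusEquiv : HomeoPlus ≃* (ℝ ≃o ℝ) where
  toFun f := { f.1.toEquiv with map_rel_iff' := f.2.le_iff_le }
  invFun e := ⟨e.toHomeomorph, e.strictMono⟩
  left_inv _ := rfl
  right_inv _ := rfl
  map_mul' _ _ := rfl

/-- A representation, as an action by order automorphisms. -/
def LineRep.toHom {G : Type*} [Group G] (ρ : LineRep G) : G →* (ℝ ≃o ℝ) :=
  homeoPlusEquiv.toMonoidHom.comp ρ

/-- The representation given by an action by order automorphisms. -/
def LineRep.ofHom {G : Type*} [Group G] (f : G →* (ℝ ≃o ℝ)) : LineRep G :=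
  homeoPlusEquiv.symm.toMonoidHom.comp f

theorem LineRep.act_apply {G : Type*} [Group G] (ρ : LineRep G) (g : G) (x : ℝ) :
    ρ.act g x = ρ.toHom g x := rfl

open Filter in
/-- The elements on which the actions `F k` eventually agree with `f` on every left half-line. -/
def stableSubgroup {G : Type*} [Group G] (F : ℕ → G →* (ℝ ≃o ℝ)) (f : G →* (ℝ ≃o ℝ)) :
    Subgroup G where
  carrier := {g | ∀ R : ℝ, ∀ᶠ k in atTop, ∀ x ≤ R, F k g x = f g x}
  one_mem' R := Eventually.of_forall fun k x _ => by simp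
  mul_mem' {g h} hg hh R := by
    filter_upwards [hh R, hg (f h R)] with k h1 h2 x hx
    rw [map_mul, map_mul, RelIso.mul_apply, RelIso.mul_apply, h1 x hx, h2 _ ((f h).monotone hx)]
  inv_mem' {g} hg R := by
    filter_upwards [hg ((f g)⁻¹ R)] with k h1 x hx
    rw [map_inv, map_inv, inv_apply_eq_iff, h1 _ ((f g)⁻¹.monotone hx), RelIso.apply_inv_self]

open Filter in
theorem stableSubgroup_freeGroup_eq_top {ι : Type*} {F : ℕ → FreeGroup ι →* (ℝ ≃o ℝ)}
    {f : FreeGroup ι →* (ℝ ≃o ℝ)} (h : ∀ k : ℕ, AgreeBelow k (gens f) (gens (F k))) :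
    stableSubgroup F f = ⊤ := by
  rw [eq_top_iff, ← FreeGroup.closure_range_of, Subgroup.closure_le]
  rintro _ ⟨i, rfl⟩ R
  filter_upwards [tendsto_natCast_atTop_atTop.eventually_ge_atTop (max R (gens f i R))]
    with k hk x hx
  exact h k i x (hx.trans ((le_max_left _ _).trans hk))
    (((gens f i).monotone hx).trans ((le_max_right _ _).trans hk))

open Filter in
/-- Actions that eventually agree with `f` on every left half-line converge to `f`. -/
theorem tendsto_ofHom {G : Type*} [Group G] {F : ℕ → G →* (ℝ ≃o ℝ)} {ρ : LineRep G}
    (h : stableSubgroup F ρ.toHom = ⊤) : Tendsto (fun k => LineRep.ofHom (F k)) atTop (𝓝 ρ) := by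
  rw [nhds_induced, tendsto_comap_iff, tendsto_pi_nhds]
  intro g
  rw [ContinuousMap.tendsto_iff_forall_isCompact_tendstoUniformlyOn]
  intro K hK
  obtain ⟨R, hR⟩ := hK.bddAbove
  have hg : g ∈ stableSubgroup F ρ.toHom := h ▸ Subgroup.mem_top g
  intro V hV
  filter_upwards [hg R] with k hk x hx
  have h1 : (LineRep.ofHom (F k)).act g x = ρ.act g x := hk x (hR hx)
  simp only [Function.comp_apply, h1]
  exact refl_mem_uniformity hV

open Filter in
/-- A flexibility criterion: it is enough to approximate `ρ`, on every left half-line, by actions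
that are not mapped to it by a monotone equivariant map that tends to `+∞` at `+∞`. -/
theorem LineRep.flexible_of_stable {G : Type*} [Group G] {ρ : LineRep G}
    {F : ℕ → G →* (ℝ ≃o ℝ)} (h : stableSubgroup F ρ.toHom = ⊤)
    (hfix : ∀ k x, ¬ ∀ g, F k g x = x)
    (hc : ∀ k, ¬ ∃ c : ℝ → ℝ, Monotone c ∧ Tendsto c atTop atTop ∧
      ∀ g x, c (F k g x) = ρ.toHom g (c x)) : ρ.Flexible := by
  rintro ⟨U, hU, hrigid⟩
  obtain ⟨k, hk⟩ := ((tendsto_ofHom h).eventually hU).exists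
  obtain ⟨c, hcm, hcb, hce⟩ := hrigid _ hk
    (Set.eq_empty_iff_forall_notMem.2 fun x hx => hfix k x hx)
  refine hc k ⟨c, hcm, ?_, hce⟩
  refine tendsto_atTop_atTop_of_monotone hcm fun B => ?_
  obtain ⟨b, hb⟩ := (hcb _ (isCompact_Icc (a := c 0) (b := B))).bddAbove
  by_contra! hB
  -- A map `c` bounded by `B` would have an unbounded preimage of `[c 0, B]`.
  have h1 := hb (show max 0 b + 1 ∈ c ⁻¹' Set.Icc (c 0) B from
    ⟨hcm (by positivity), (hB _).le⟩)
  linarith [le_max_right 0 b]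

theorem exists_conj_isCyclicallyReduced {ι : Type*} (w : FreeGroup ι) :
    ∃ (u : FreeGroup ι) (L : List (ι × Bool)), FreeGroup.IsCyclicallyReduced L ∧
      w = u * FreeGroup.mk L * u⁻¹ ∧ (L = [] ↔ w = 1) := by
  classical
  have hred := FreeGroup.reduceCyclically.isCyclicallyReduced (FreeGroup.isReduced_toWord (x := w))
  refine ⟨FreeGroup.mk (FreeGroup.reduceCyclically.conjugator w.toWord),
    FreeGroup.reduceCyclically w.toWord, hred, ?_⟩
  have h : w = FreeGroup.mk (FreeGroup.reduceCyclically.conjugator w.toWord) *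
      FreeGroup.mk (FreeGroup.reduceCyclically w.toWord) *
      (FreeGroup.mk (FreeGroup.reduceCyclically.conjugator w.toWord))⁻¹ := by
    rw [FreeGroup.inv_mk, FreeGroup.mul_mk, FreeGroup.mul_mk,
      FreeGroup.reduceCyclically.conj_conjugator_reduceCyclically, FreeGroup.mk_toWord]
  refine ⟨h, fun hL => ?_, fun hw => by rw [hw]; simp⟩
  rwa [hL, ← FreeGroup.one_eq_mk, mul_one, mul_inv_cancel] at h

theorem gens_conj_fixed_iff {ι : Type*} {u : FreeGroup ι} {σ : FreeGroup ι →* (ℝ ≃o ℝ)} {x : ℝ} :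
    (∀ i, gens (σ.comp (MulAut.conj u).toMonoidHom) i x = x) ↔ ∀ g, σ g x = x := by
  rw [gens_fixed_iff]
  exact ⟨fun h g => by simpa [mul_assoc] using h (u⁻¹ * g * u), fun h g => h _⟩

theorem stableSubgroup_conj_eq_top {ι : Type*} {u : FreeGroup ι} {σ : FreeGroup ι →* (ℝ ≃o ℝ)}
    {τ : ℕ → FreeGroup ι →* (ℝ ≃o ℝ)}
    (h : ∀ k : ℕ, AgreeBelow k (gens (σ.comp (MulAut.conj u).toMonoidHom)) (gens (τ k))) :
    stableSubgroup (fun k => (τ k).comp (MulAut.conj u⁻¹).toMonoidHom) σ = ⊤ := by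
  refine (Subgroup.eq_top_iff' _).2 fun g R => ?_
  have hg : u⁻¹ * g * u ∈ stableSubgroup τ (σ.comp (MulAut.conj u).toMonoidHom) := by
    rw [stableSubgroup_freeGroup_eq_top h]; exact Subgroup.mem_top _
  simpa [mul_assoc] using hg R

theorem conj_inv_apply {ι : Type*} (u : FreeGroup ι) (τ : FreeGroup ι →* (ℝ ≃o ℝ))
    (g : FreeGroup ι) : τ.comp (MulAut.conj u⁻¹).toMonoidHom (u * g * u⁻¹) = τ g := by
  simp only [MonoidHom.comp_apply, MulEquiv.coe_toMonoidHom, MulAut.conj_apply]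
  congr 1
  group

/-- Every pair of actions without common fixed points which satisfies the relation `w₁ = w₂` is a
limit of such pairs that are not mapped to it by a proper monotone equivariant map. -/
theorem exists_approximating_pairs {ι κ : Type*} [Finite ι] [Nontrivial ι] [Finite κ] [Nonempty κ]
    {w₁ : FreeGroup ι} {w₂ : FreeGroup κ} (hw : w₁ = 1 ↔ w₂ = 1)
    {σ₁ : FreeGroup ι →* (ℝ ≃o ℝ)} {σ₂ : FreeGroup κ →* (ℝ ≃o ℝ)} (hσ : σ₁ w₁ = σ₂ w₂)
    (hfix : ∀ x, ¬ ((∀ g, σ₁ g x = x) ∧ ∀ g, σ₂ g x = x)) :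
    ∃ (F₁ : ℕ → FreeGroup ι →* (ℝ ≃o ℝ)) (F₂ : ℕ → FreeGroup κ →* (ℝ ≃o ℝ)),
      stableSubgroup F₁ σ₁ = ⊤ ∧ stableSubgroup F₂ σ₂ = ⊤ ∧ ∀ k, F₁ k w₁ = F₂ k w₂ ∧
      (∀ x, ¬ ((∀ g, F₁ k g x = x) ∧ ∀ g, F₂ k g x = x)) ∧
      ¬ ∃ c : ℝ → ℝ, Monotone c ∧ Filter.Tendsto c Filter.atTop Filter.atTop ∧
        (∀ g x, c (F₁ k g x) = σ₁ g (c x)) ∧ ∀ g x, c (F₂ k g x) = σ₂ g (c x) := by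
  obtain ⟨u₁, L₁, hred₁, hw₁, hL₁⟩ := exists_conj_isCyclicallyReduced w₁
  obtain ⟨u₂, L₂, hred₂, hw₂, hL₂⟩ := exists_conj_isCyclicallyReduced w₂
  -- Twisting both actions by inner automorphisms replaces the words by their cyclic reductions.
  have hD := fun k : ℕ => deformable_of_isCyclicallyReduced (hL₁.trans (hw.trans hL₂.symm))
    hred₁ hred₂ (σ₁ := σ₁.comp (MulAut.conj u₁).toMonoidHom)
    (σ₂ := σ₂.comp (MulAut.conj u₂).toMonoidHom)
    (by simpa [← hw₁, ← hw₂] using hσ)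
    (fun x hx => hfix x ⟨(gens_conj_fixed_iff).1 hx.1, (gens_conj_fixed_iff).1 hx.2⟩) (k : ℝ)
  choose τ₁ τ₂ h₁ h₂ hτ hτfix hτc using hD
  refine ⟨fun k => (τ₁ k).comp (MulAut.conj u₁⁻¹).toMonoidHom,
    fun k => (τ₂ k).comp (MulAut.conj u₂⁻¹).toMonoidHom, stableSubgroup_conj_eq_top h₁,
    stableSubgroup_conj_eq_top h₂,
    fun k => ⟨?_, fun x hx => hτfix k x ⟨fun i => ?_, fun i => ?_⟩, ?_⟩⟩
  · rw [hw₁, hw₂, conj_inv_apply, conj_inv_apply, hτ]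
  · have h := hx.1 (u₁ * FreeGroup.of i * u₁⁻¹)
    rwa [conj_inv_apply] at h
  · have h := hx.2 (u₂ * FreeGroup.of i * u₂⁻¹)
    rwa [conj_inv_apply] at h
  · rintro ⟨c, hcm, hct, hc₁, hc₂⟩
    exact hτc k ⟨c, hcm, hct, fun g x => by rw [← conj_inv_apply u₁ (τ₁ k) g, hc₁]; rfl,
      fun g x => by rw [← conj_inv_apply u₂ (τ₂ k) g, hc₂]; rfl⟩

/-- Two actions that agree on the amalgamated words define an action of the amalgam. -/
def amalgamHom {n m : ℕ} {w₁ : FreeGroup (Fin n)} {w₂ : FreeGroup (Fin m)}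
    (f₁ : FreeGroup (Fin n) →* (ℝ ≃o ℝ)) (f₂ : FreeGroup (Fin m) →* (ℝ ≃o ℝ))
    (h : f₁ w₁ = f₂ w₂) : CyclicAmalgam w₁ w₂ →* (ℝ ≃o ℝ) :=
  Monoid.PushoutI.lift
    (fun b => match b with
      | false => f₁
      | true => f₂)
    (zpowersHom (ℝ ≃o ℝ) (f₁ w₁))
    (by
      rintro (_ | _)
      · ext : 1
        simp [cyclicMap]
      · ext : 1
        simp [cyclicMap, h])

/-- A property of the elements of the amalgam that holds on the factors and is stable under
products always holds. -/
theorem amalgam_induction {n m : ℕ} {w₁ : FreeGroup (Fin n)} {w₂ : FreeGroup (Fin m)}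
    {p : CyclicAmalgam w₁ w₂ → Prop}
    (h₁ : ∀ g : FreeGroup (Fin n), p (Monoid.PushoutI.of (φ := cyclicMap w₁ w₂) false g))
    (h₂ : ∀ g : FreeGroup (Fin m), p (Monoid.PushoutI.of (φ := cyclicMap w₁ w₂) true g))
    (hmul : ∀ a b, p a → p b → p (a * b)) (g : CyclicAmalgam w₁ w₂) : p g := by
  induction g using Monoid.PushoutI.induction_on with
  | of i g => cases i with
    | false => exact h₁ g
    | true => exact h₂ g
  | base k => rw [← Monoid.PushoutI.of_apply_eq_base _ false]; exact h₁ _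
  | mul a b ha hb => exact hmul a b ha hb

theorem amalgamHom_of_false {n m : ℕ} {w₁ : FreeGroup (Fin n)} {w₂ : FreeGroup (Fin m)}
    {f₁ : FreeGroup (Fin n) →* (ℝ ≃o ℝ)} {f₂ : FreeGroup (Fin m) →* (ℝ ≃o ℝ)}
    (h : f₁ w₁ = f₂ w₂) (g : FreeGroup (Fin n)) :
    amalgamHom f₁ f₂ h (Monoid.PushoutI.of (φ := cyclicMap w₁ w₂) false g) = f₁ g :=
  Monoid.PushoutI.lift_of _ _ _ _

theorem amalgamHom_of_true {n m : ℕ} {w₁ : FreeGroup (Fin n)} {w₂ : FreeGroup (Fin m)}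
    {f₁ : FreeGroup (Fin n) →* (ℝ ≃o ℝ)} {f₂ : FreeGroup (Fin m) →* (ℝ ≃o ℝ)}
    (h : f₁ w₁ = f₂ w₂) (g : FreeGroup (Fin m)) :
    amalgamHom f₁ f₂ h (Monoid.PushoutI.of (φ := cyclicMap w₁ w₂) true g) = f₂ g :=
  Monoid.PushoutI.lift_of _ _ _ _

/-- The hypothesis `hw` says that `⟨w₁⟩` and `⟨w₂⟩` are isomorphic via `w₁ ↦ w₂` (free groups being
torsion free), so that the amalgamated product makes sense. -/
theorem mainTheorem1 (n m : ℕ) (hn : 2 ≤ n) (hm : 1 ≤ m)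
    (w₁ : FreeGroup (Fin n)) (w₂ : FreeGroup (Fin m)) (hw : w₁ = 1 ↔ w₂ = 1)
    (ρ : LineRep (CyclicAmalgam w₁ w₂)) (hρ : ρ.Fix = ∅) :
    ρ.Flexible := by
  have : Nontrivial (Fin n) := Fin.nontrivial_iff_two_le.2 hn
  have : Nonempty (Fin m) := ⟨⟨0, hm⟩⟩
  let σ₁ : FreeGroup (Fin n) →* (ℝ ≃o ℝ) :=
    ρ.toHom.comp (Monoid.PushoutI.of (φ := cyclicMap w₁ w₂) false)
  let σ₂ : FreeGroup (Fin m) →* (ℝ ≃o ℝ) :=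
    ρ.toHom.comp (Monoid.PushoutI.of (φ := cyclicMap w₁ w₂) true)
  have hσ : σ₁ w₁ = σ₂ w₂ := by
    have h₁ := Monoid.PushoutI.of_apply_eq_base (cyclicMap w₁ w₂) false (Multiplicative.ofAdd 1)
    have h₂ := Monoid.PushoutI.of_apply_eq_base (cyclicMap w₁ w₂) true (Multiplicative.ofAdd 1)
    have h := congrArg ρ.toHom (h₁.trans h₂.symm)
    simpa [cyclicMap, σ₁, σ₂] using h
  have hfix : ∀ x, ¬ ((∀ g, σ₁ g x = x) ∧ ∀ g, σ₂ g x = x) := by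
    rintro x ⟨h₁, h₂⟩
    refine Set.eq_empty_iff_forall_notMem.1 hρ x fun g => ?_
    rw [LineRep.act_apply]
    induction g using amalgam_induction with
    | h₁ g => exact h₁ g
    | h₂ g => exact h₂ g
    | hmul a b ha hb => rw [map_mul, RelIso.mul_apply, hb, ha]
  obtain ⟨F₁, F₂, hF₁, hF₂, hF⟩ := exists_approximating_pairs hw hσ hfix
  refine LineRep.flexible_of_stable (F := fun k => amalgamHom (F₁ k) (F₂ k) (hF k).1)
    ((Subgroup.eq_top_iff' _).2 fun g => ?_) (fun k x hx => (hF k).2.1 x ⟨fun g => ?_, fun g => ?_⟩)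
    fun k hk => (hF k).2.2 ?_
  · induction g using amalgam_induction with
    | h₁ g =>
      have hg : g ∈ stableSubgroup F₁ σ₁ := hF₁ ▸ Subgroup.mem_top g
      intro R
      simpa only [amalgamHom_of_false, σ₁, MonoidHom.comp_apply] using hg R
    | h₂ g =>
      have hg : g ∈ stableSubgroup F₂ σ₂ := hF₂ ▸ Subgroup.mem_top g
      intro R
      simpa only [amalgamHom_of_true, σ₂, MonoidHom.comp_apply] using hg R
    | hmul a b ha hb => exact mul_mem ha hb
  · rw [← amalgamHom_of_false (hF k).1]; exact hx _
  · rw [← amalgamHom_of_true (hF k).1]; exact hx _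
  · obtain ⟨c, hcm, hct, hc⟩ := hk
    refine ⟨c, hcm, hct, fun g x => ?_, fun g x => ?_⟩
    · rw [← amalgamHom_of_false (hF k).1, hc]; rfl
    · rw [← amalgamHom_of_true (hF k).1, hc]; rfl
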